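/- All lattices are finite. An element $a$ of a lattice is \emph{reducible} if $a=b\wedge c$ (meet-reducible) or $a=b\vee c$ (join-reducible) for some $b,c\neq a$. A \emph{block} is a lattice whose largest element is join-reducible and whose smallest element is meet-reducible. The \emph{nullity} of a poset is $p-q+c$, where $p,q,c$ are the numbers of edges, vertices and connected components of its cover graph. In a finite poset $P$, let $\mathrm{Irr}(P)$ be the set of elements with at most one upper and at most one lower cover, $\mathrm{Irr}^*(P)$ the set of those with exactly one of each, and $\mathrm{Red}(P)=P\setminus\mathrm{Irr}(P)$. An element $x\in\mathrm{Irr}(P)$ is \emph{retractible} if either there are no $y,z\in\mathrm{Red}(P)$ with $y\prec x\prec z$, or there are such $y,z$ and $y\prec x\prec z$ is the only directed path (sequence of successive coverings) from $y$ to $z$. The \emph{basic block associated to} $P$ is obtained (up to isomorphism) from $P$ by successively removing retractible elements of $\mathrm{Irr}^*$ until none is left, and then successively removing all pendant vertices of the cover graph. Let $\mathscr{B}(j;4,3)$ be the class of isomorphism classes of blocks on $j$ elements having exactly four reducible elements, these being pairwise comparable, and nullity three; let $\mathscr{B}(j;4,3,3)$ be the subclass of those whose associated basic block has height $3$ (the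 height being the number of coverings in a longest chain). Let $C:0\prec a\prec b\prec 1$ be a $4$-chain, and let $B_1,B_2,B_3$ be the $7$-element lattices obtained from $C$ by adding three elements $c_1,c_2,c_3$, each $c_i$ being placed between the two members of a pair $(u_i,v_i)$ of elements of $C$ as a new element with unique lower cover $u_i$ and unique upper cover $v_i$, where the three pairs are $(a,1),(0,b),(0,b)$ for $B_1$; $(0,b),(a,1),(a,1)$ for $B_2$ (the dual of $B_1$); and $(0,b),(a,1),(0,1)$ for $B_3$. Let $\mathbb{B}_i(j;4,3)$ be the subclass of $\mathscr{B}(j;4,3)$ of those blocks whose associated basic block is isomorphic to $B_i$. Let $P_n^k$ be the number of partitions of $n$ into exactly $k$ positive parts. Theorem. For every integer $j\ge 7$, $$|\mathscr{B}(j;4,3,3)|=\sum_{i=1}^{3}|\mathbb{B}_i(j;4,3)|=\sum_{s=1}^{j-6}\;\sum_{r=1}^{j-s-5}\;\sum_{l=2}^{j-s-r-3}2\,(j-s-r-l-2)\,P_l^2\;+\;\sum_{p=1}^{j-6}\binom{j-p-2}{4}.$$ -/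

import Mathlib

namespace RCLattice

section Posets

variable {P : Type*} [PartialOrder P]

/-- `x` is doubly irreducible in the poset `P`: at most one lower cover and at most one
upper cover. -/
def Irr (x : P) : Prop :=
  {y : P | y ⋖ x}.Subsingleton ∧ {z : P | x ⋖ z}.Subsingleton

/-- `x` has exactly one lower cover and exactly one upper cover in `P`. -/
def IrrStar (x : P) : Prop :=
  (∃! y : P, y ⋖ x) ∧ (∃! z : P, x ⋖ z)

/-- `x` is a retractible element of `P`: it is doubly irreducible and either it does not lie
immediately between two elements that are not doubly irreducible, or it does, say between `y`
and `z`, and `y ⋖ x ⋖ z` is the only directed path (sequence of successive coverings) from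
`y` to `z`. -/
def Retractible (x : P) : Prop :=
  Irr x ∧
    ((¬ ∃ y z : P, ¬ Irr y ∧ ¬ Irr z ∧ y ⋖ x ∧ x ⋖ z) ∨
      (∃ y z : P, ¬ Irr y ∧ ¬ Irr z ∧ y ⋖ x ∧ x ⋖ z ∧
        ∀ l : List P, l.IsChain (· ⋖ ·) → l.head? = some y → l.getLast? = some z →
          l = [y, x, z]))

/-- `x` is a pendant vertex (a vertex of degree one) of the cover graph of `P`. -/
def Pendant (x : P) : Prop :=
  ((SimpleGraph.hasse P).neighborSet x).ncard = 1

/-- Passing from the subposet `S` to the subposet `T` by removing one retractible element of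
`Irr*(S)`. -/
def RetractStep (S T : Set P) : Prop :=
  ∃ x : S, IrrStar x ∧ Retractible x ∧ T = S \ {(x : P)}

/-- Passing from the subposet `S` to the subposet `T` by removing one pendant vertex of `S`. -/
def PendantStep (S T : Set P) : Prop :=
  ∃ x : S, Pendant x ∧ T = S \ {(x : P)}

/-- `R` is a basic retract associated to `P`: it is obtained from `P` by successive removal of
retractible elements of `Irr*`, until none is left. -/
def IsBasicRetractOf (R : Set P) : Prop :=
  Relation.ReflTransGen RetractStep Set.univ R ∧ ∀ x : R, IrrStar x → ¬ Retractible x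

/-- `B` is a basic block associated to `P`: it is obtained from a basic retract associated to
`P` by successive removal of all the pendant vertices. -/
def IsBasicBlockOf (B : Set P) : Prop :=
  ∃ R : Set P, IsBasicRetractOf R ∧ Relation.ReflTransGen PendantStep R B ∧
    ∀ x : B, ¬ Pendant x

variable (P) in
/-- The nullity of the cover graph of `P`: edges minus vertices plus connected components. -/
noncomputable def nullity : ℤ :=
  ((SimpleGraph.hasse P).edgeSet.ncard : ℤ) - (Nat.card P : ℤ)
    + (Nat.card (SimpleGraph.hasse P).ConnectedComponent : ℤ)

end Posets

section Lattices

variable {L : Type*} [Lattice L]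

def MeetReducible (a : L) : Prop := ∃ b c : L, b ≠ a ∧ c ≠ a ∧ b ⊓ c = a

def JoinReducible (a : L) : Prop := ∃ b c : L, b ≠ a ∧ c ≠ a ∧ b ⊔ c = a

def Reducible (a : L) : Prop := MeetReducible a ∨ JoinReducible a

variable (L) in
/-- A block: the largest element is join-reducible and the smallest is meet-reducible. -/
def IsBlock : Prop :=
  (∃ t : L, IsTop t ∧ JoinReducible t) ∧ (∃ b : L, IsBot b ∧ MeetReducible b)

variable (L) in
/-- `L` is a block with exactly `r` reducible elements, these being pairwise comparable, and
with nullity `k`. -/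
def IsRCBlock (r k : ℕ) : Prop :=
  IsBlock L ∧ {a : L | Reducible a}.ncard = r ∧ IsChain (· ≤ ·) {a : L | Reducible a} ∧
    nullity L = k

variable (L) in
/-- The basic block associated to `L` has height (length of a longest chain) `h`. -/
def HasBasicBlockHeight (h : ℕ) : Prop :=
  ∃ S : Set L, IsBasicBlockOf S ∧ Order.krullDim S = (h : WithBot ℕ∞)

variable (L) in
/-- The basic block associated to `L` is isomorphic to `B`. -/
def HasBasicBlock (B : Type) [PartialOrder B] : Prop :=
  ∃ S : Set L, IsBasicBlockOf S ∧ Nonempty (S ≃o B)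

end Lattices

/-- Isomorphism of lattice structures on `Fin n`. -/
def latticeIso (n : ℕ) : Setoid (Lattice (Fin n)) where
  r L M := Nonempty (@OrderIso (Fin n) (Fin n) L.toLE M.toLE)
  iseqv :=
    ⟨fun L => ⟨@OrderIso.refl (Fin n) L.toLE⟩,
      fun {L M} ⟨e⟩ => ⟨@OrderIso.symm (Fin n) (Fin n) L.toLE M.toLE e⟩,
      fun {L M N} ⟨e⟩ ⟨f⟩ =>
        ⟨@OrderIso.trans (Fin n) (Fin n) (Fin n) L.toLE M.toLE N.toLE e f⟩⟩

/-- The isomorphism classes of lattices on `n` elements. -/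
def LatticeClass (n : ℕ) : Type := Quotient (latticeIso n)

/-- The isomorphism class of a lattice structure on `Fin n`. -/
def classOf {n : ℕ} (L : Lattice (Fin n)) : LatticeClass n := Quotient.mk (latticeIso n) L

/-- `𝓑(j; r, k, h)`: isomorphism classes of blocks on `j` elements with exactly `r` reducible
elements, all comparable, with nullity `k`, whose associated basic block has height `h`. -/
def blockClass (j r k h : ℕ) : Set (LatticeClass j) :=
  classOf '' {L : Lattice (Fin j) | @IsRCBlock (Fin j) L r k ∧ @HasBasicBlockHeight (Fin j) L h}

/-- Isomorphism classes of blocks on `j` elements with exactly `r` reducible elements, all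
comparable, with nullity `k`, whose associated basic block is isomorphic to `B`. -/
def blockClassOfType (j r k : ℕ) (B : Type) [PartialOrder B] : Set (LatticeClass j) :=
  classOf '' {L : Lattice (Fin j) | @IsRCBlock (Fin j) L r k ∧ @HasBasicBlock (Fin j) L B _}

/-- The underlying set of the iterated adjunct of the `4`-chain `0 < 1 < 2 < 3` with three
one-element chains `c₀, c₁, c₂`, where `c` is attached at the adjunct pair `p c`. -/
inductive ChainAdjunct (p : Fin 3 → {q : Fin 4 × Fin 4 // q.1 < q.2}) : Type
  | chain (x : Fin 4)
  | pt (c : Fin 3)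

/-- The order of the iterated adjunct: `x ≤ c` iff `x` is below the lower member of the pair
of `c`, and `c ≤ y` iff `y` is above the upper member. -/
def ChainAdjunct.le {p : Fin 3 → {q : Fin 4 × Fin 4 // q.1 < q.2}} :
    ChainAdjunct p → ChainAdjunct p → Prop
  | .chain x, .chain y => x ≤ y
  | .chain x, .pt c => x ≤ (p c).1.1
  | .pt c, .chain y => (p c).1.2 ≤ y
  | .pt c, .pt d => c = d ∨ (p c).1.2 ≤ (p d).1.1

instance (p : Fin 3 → {q : Fin 4 × Fin 4 // q.1 < q.2}) : PartialOrder (ChainAdjunct p) where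
  le := ChainAdjunct.le
  le_refl x := by cases x <;> simp [ChainAdjunct.le]
  le_trans x y z hxy hyz := by
    rcases x with x | x <;> rcases y with y | y <;> rcases z with z | z <;>
      simp only [ChainAdjunct.le] at hxy hyz ⊢ <;> grind
  le_antisymm x y hxy hyx := by
    rcases x with x | x <;> rcases y with y | y <;> simp only [ChainAdjunct.le] at hxy hyx
    · rw [le_antisymm hxy hyx]
    · have h := (p y).2; grind
    · have h := (p x).2; grind
    · have h := (p x).2; have h1 := (p y).2; grind

/-- The adjunct pairs of the three basic blocks. With `0 < a < b < 1` the elements of the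
`4`-chain: `(a,1), (0,b), (0,b)` for the first, `(0,b), (a,1), (a,1)` for the second (the dual of
the first) and `(0,b), (a,1), (0,1)` for the third. -/
def basicPairs : Fin 3 → Fin 3 → {q : Fin 4 × Fin 4 // q.1 < q.2} :=
  ![![⟨(1, 3), by decide⟩, ⟨(0, 2), by decide⟩, ⟨(0, 2), by decide⟩],
    ![⟨(0, 2), by decide⟩, ⟨(1, 3), by decide⟩, ⟨(1, 3), by decide⟩],
    ![⟨(0, 2), by decide⟩, ⟨(1, 3), by decide⟩, ⟨(0, 3), by decide⟩]]

/-- The basic blocks `B₁, B₂, B₃` (indexed from `0`). -/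
abbrev BasicB (i : Fin 3) : Type := ChainAdjunct (basicPairs i)

/-- The number of partitions of `n` into exactly `k` positive parts. -/
def partitionCount (n k : ℕ) : ℕ :=
  (Finset.univ.filter fun q : n.Partition => q.parts.card = k).card

end RCLattice

/-!
Let `P` be a block whose reducible elements form a chain with four members. Every other element has
exactly one upper and one lower cover, so it lies in the interior of a covering path between two
reducible elements: `P` is a chain of four nodes with finite chains strung on the edges of a
multigraph, and its nullity counts the edges other than those joining consecutive nodes. Retraction
shortens every edge, down to one element if its endpoints would otherwise be joined twice and down
to none if not. Hence the basic block remembers precisely the multigraph, and nullity three together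
with height three leaves only the three choices of adjunct pairs. A lattice with a given multigraph
is determined by the numbers of elements on its edges, up to a swap of parallel edges; what remains
is to count compositions of `j - 4`.
-/

namespace RCLattice

section FinitePosets

variable {P : Type*} [PartialOrder P]

theorem subsingleton_setOf_toDual_covBy {x : P} :
    {z : Pᵒᵈ | OrderDual.toDual x ⋖ z}.Subsingleton ↔ {y : P | y ⋖ x}.Subsingleton :=
  ⟨fun h _ hy _ hz ↦ h (toDual_covBy_toDual_iff.2 hy) (toDual_covBy_toDual_iff.2 hz),
    fun h _ hy _ hz ↦ h (ofDual_covBy_ofDual_iff.2 hy) (ofDual_covBy_ofDual_iff.2 hz)⟩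

theorem subsingleton_setOf_covBy_toDual {x : P} :
    {y : Pᵒᵈ | y ⋖ OrderDual.toDual x}.Subsingleton ↔ {z : P | x ⋖ z}.Subsingleton :=
  ⟨fun h _ hy _ hz ↦ h (toDual_covBy_toDual_iff.2 hy) (toDual_covBy_toDual_iff.2 hz),
    fun h _ hy _ hz ↦ h (ofDual_covBy_ofDual_iff.2 hy) (ofDual_covBy_ofDual_iff.2 hz)⟩

theorem irr_toDual {x : P} : Irr (OrderDual.toDual x) ↔ Irr x := by
  rw [Irr, subsingleton_setOf_covBy_toDual, subsingleton_setOf_toDual_covBy, and_comm, Irr]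

theorem eq_of_covBy_of_le_or_le {x y z : P} (hy : x ⋖ y) (hz : x ⋖ z) (h : y ≤ z ∨ z ≤ y) :
    y = z := by
  rcases h with h | h
  · exact (hz.eq_or_eq hy.le h).resolve_left hy.ne'
  · exact ((hy.eq_or_eq hz.le h).resolve_left hz.ne').symm

theorem neighborSet_hasse (x : P) :
    (SimpleGraph.hasse P).neighborSet x = {z | x ⋖ z} ∪ {y | y ⋖ x} := rfl

theorem not_pendant_of_not_irr {x : P} (hx : ¬ Irr x) : ¬ Pendant x := by
  intro h
  obtain ⟨a, ha⟩ := Set.ncard_eq_one.1 h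
  have hsub : ({z | x ⋖ z} ∪ {y | y ⋖ x} : Set P).Subsingleton :=
    neighborSet_hasse x ▸ ha ▸ Set.subsingleton_singleton
  exact hx ⟨hsub.anti Set.subset_union_right, hsub.anti Set.subset_union_left⟩

theorem not_pendant_of_irrStar {x : P} (hx : IrrStar x) : ¬ Pendant x := by
  intro h
  obtain ⟨a, ha⟩ := Set.ncard_eq_one.1 h
  have hsub : ({z | x ⋖ z} ∪ {y | y ⋖ x} : Set P).Subsingleton :=
    neighborSet_hasse x ▸ ha ▸ Set.subsingleton_singleton
  obtain ⟨⟨y, hy, -⟩, ⟨z, hz, -⟩⟩ := hx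
  exact (hy.lt.trans hz.lt).ne (hsub (Or.inr hy) (Or.inl hz))

theorem IrrStar.irr {x : P} (hx : IrrStar x) : Irr x :=
  ⟨fun _ hy _ hz ↦ hx.1.unique hy hz, fun _ hy _ hz ↦ hx.2.unique hy hz⟩

variable [Finite P]

theorem reflTransGen_covBy_of_le {x y : P} (h : x ≤ y) : Relation.ReflTransGen (· ⋖ ·) x y := by
  cases nonempty_fintype P
  classical
  let := Fintype.toLocallyFiniteOrder (α := P)
  exact le_iff_reflTransGen_covBy.1 h

theorem Ioo_subset_singleton_iff_forall_isChain {x y z : P} (hyx : y ⋖ x) (hxz : x ⋖ z) :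
    (∀ l : List P, l.IsChain (· ⋖ ·) → l.head? = some y → l.getLast? = some z → l = [y, x, z]) ↔
      Set.Ioo y z ⊆ {x} := by
  constructor
  · intro h w hw
    obtain ⟨l, hl, hlast⟩ :=
      List.exists_isChain_cons_of_relationReflTransGen (reflTransGen_covBy_of_le hw.1.le)
    obtain ⟨m, hm, hmlast⟩ :=
      List.exists_isChain_cons_of_relationReflTransGen (reflTransGen_covBy_of_le hw.2.le)
    obtain ⟨l', hl'⟩ : ∃ l', y :: l = l' ++ [w] :=
      ⟨_, (hlast ▸ List.dropLast_append_getLast (List.cons_ne_nil y l)).symm⟩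
    have hhead : (l' ++ w :: m).head? = some y := by
      rw [List.append_cons, ← hl', List.cons_append, List.head?_cons]
    have hlast' : (l' ++ w :: m).getLast? = some z := by
      rw [List.getLast?_append_cons, List.getLast?_eq_some_getLast (List.cons_ne_nil w m), hmlast]
    have hpath := h _ (List.isChain_split.2 ⟨hl' ▸ hl, hm⟩) hhead hlast'
    have hmem : w ∈ [y, x, z] := hpath ▸ List.mem_append_right l' List.mem_cons_self
    simpa [hw.1.ne', hw.2.ne] using hmem
  · intro h l hl hhead hlast
    obtain ⟨l, rfl⟩ := List.head?_eq_some_iff.1 hhead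
    obtain ⟨m, hm⟩ := List.getLast?_eq_some_iff.1 hlast
    obtain _ | ⟨_, m⟩ := m
    · exact absurd (List.cons_eq_cons.1 hm).1 (hyx.lt.trans hxz.lt).ne
    obtain ⟨rfl, rfl⟩ := List.cons_eq_cons.1 hm
    have hlt : (y :: (m ++ [z])).Pairwise (· < ·) := (hl.imp fun _ _ ↦ CovBy.lt).pairwise
    simp only [List.pairwise_cons, List.pairwise_append, List.mem_append,
      List.mem_singleton] at hlt
    obtain ⟨hy, hm, -, hz⟩ := hlt
    have eq_x (w : P) (hw : w ∈ m) : w = x := h ⟨hy w (Or.inl hw), hz w hw z rfl⟩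
    obtain _ | ⟨a, _ | ⟨b, m⟩⟩ := m
    · exact absurd (List.isChain_pair.1 hl) (not_covBy_of_lt_of_lt hyx.lt hxz.lt)
    · obtain rfl := eq_x a List.mem_cons_self
      rfl
    · have hab : a < b := List.rel_of_pairwise_cons hm List.mem_cons_self
      exact absurd ((eq_x a (by simp)).trans (eq_x b (by simp)).symm) hab.ne

theorem le_or_le_of_forall_irr_of_le {x y z : P} (hy : y ≤ x) (hz : z ≤ x)
    (hirr : ∀ w ∈ Set.Icc y x, Irr w) : y ≤ z ∨ z ≤ y := by
  induction x using WellFoundedLT.induction with | ind x ih => ?_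
  rcases hy.eq_or_lt with rfl | hy'
  · exact Or.inr hz
  rcases hz.eq_or_lt with rfl | hz'
  · exact Or.inl hy
  obtain ⟨a, hya, ha⟩ := exists_le_covBy_of_lt hy'
  obtain ⟨b, hzb, hb⟩ := exists_le_covBy_of_lt hz'
  obtain rfl := (hirr x ⟨hy, le_rfl⟩).1 ha hb
  exact ih a ha.lt hya hzb fun w hw ↦ hirr w ⟨hw.1, hw.2.trans ha.le⟩

theorem le_or_le_of_forall_irr_of_ge {x y z : P} (hy : x ≤ y) (hz : x ≤ z)
    (hirr : ∀ w ∈ Set.Icc x y, Irr w) : y ≤ z ∨ z ≤ y :=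
  Or.symm <| le_or_le_of_forall_irr_of_le (P := Pᵒᵈ) (OrderDual.toDual_le_toDual.2 hy)
    (OrderDual.toDual_le_toDual.2 hz)
    fun w hw ↦ (irr_toDual (x := OrderDual.ofDual w)).2 (hirr (OrderDual.ofDual w) ⟨hw.2, hw.1⟩)

theorem card_connectedComponent_hasse {b : P} (hb : IsBot b) :
    Nat.card (SimpleGraph.hasse P).ConnectedComponent = 1 := by
  have reachable_bot (x : P) : (SimpleGraph.hasse P).Reachable b x := by
    induction reflTransGen_covBy_of_le (hb x) with
    | refl => exact SimpleGraph.Reachable.refl _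
    | tail _ h ih => exact ih.trans (SimpleGraph.Adj.reachable (Or.inl h))
  have hconn : (SimpleGraph.hasse P).Connected :=
    (SimpleGraph.connected_iff_exists_forall_reachable _).2 ⟨b, reachable_bot⟩
  have := hconn.preconnected.subsingleton_connectedComponent
  have : Nonempty (SimpleGraph.hasse P).ConnectedComponent := ⟨SimpleGraph.connectedComponentMk _ b⟩
  exact Nat.card_unique

end FinitePosets

section Nullity

variable {P : Type*} [PartialOrder P]

theorem ncard_edgeSet_hasse :
    (SimpleGraph.hasse P).edgeSet.ncard = Nat.card {q : P × P // q.1 ⋖ q.2} := by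
  refine (Nat.card_congr <| Equiv.ofBijective (β := (SimpleGraph.hasse P).edgeSet)
    (fun q ↦ ⟨s(q.1.1, q.1.2), Or.inl q.2⟩) ⟨?_, ?_⟩).symm
  · rintro ⟨⟨a, b⟩, hab⟩ ⟨⟨c, d⟩, hcd⟩ heq
    rcases Sym2.eq_iff.1 (congrArg Subtype.val heq) with ⟨rfl, rfl⟩ | ⟨rfl, rfl⟩
    · rfl
    · exact absurd (hab.lt.trans hcd.lt) (lt_irrefl _)
  · rintro ⟨⟨a, b⟩, hab | hba⟩
    · exact ⟨⟨(a, b), hab⟩, rfl⟩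
    · exact ⟨⟨(b, a), hba⟩, Subtype.ext Sym2.eq_swap⟩

theorem nullity_eq_sum [Fintype P] {b : P} (hb : IsBot b) :
    nullity P = ∑ x, (({z : P | x ⋖ z}.ncard : ℤ) - 1) + 1 := by
  have hedges : Nat.card {q : P × P // q.1 ⋖ q.2} = ∑ x, {z : P | x ⋖ z}.ncard := by
    rw [Nat.card_congr (Equiv.subtypeProdEquivSigmaSubtype (· ⋖ ·)), Nat.card_sigma]
    rfl
  rw [nullity, card_connectedComponent_hasse hb, ncard_edgeSet_hasse, hedges,
    Finset.sum_sub_distrib]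
  simp

end Nullity

section ReducibleElements

variable {L : Type*} [Lattice L] [Finite L] {a : L}

theorem meetReducible_iff : MeetReducible a ↔ ¬ {z : L | a ⋖ z}.Subsingleton := by
  constructor
  · rintro ⟨b, c, hb, hc, rfl⟩ hsub
    obtain ⟨y, hy, hyb⟩ := exists_covBy_le_of_lt (inf_le_left.lt_of_ne hb.symm)
    obtain ⟨z, hz, hzc⟩ := exists_covBy_le_of_lt (inf_le_right.lt_of_ne hc.symm)
    obtain rfl := hsub hy hz
    exact hy.lt.not_ge (le_inf hyb hzc)
  · intro h
    obtain ⟨b, hb, c, hc, hbc⟩ := Set.not_subsingleton_iff.1 h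
    refine ⟨b, c, hb.1.ne', hc.1.ne', ?_⟩
    rcases CovBy.eq_or_eq hb (le_inf hb.1.le hc.1.le) inf_le_left with h' | h'
    · exact h'
    · exact absurd ((CovBy.eq_or_eq hc hb.1.le (inf_eq_left.1 h')).resolve_left hb.1.ne') hbc

theorem joinReducible_iff : JoinReducible a ↔ ¬ {z : L | z ⋖ a}.Subsingleton := by
  rw [← subsingleton_setOf_toDual_covBy]
  exact meetReducible_iff (L := Lᵒᵈ)

theorem reducible_iff : Reducible a ↔ ¬ Irr a := by
  rw [Reducible, meetReducible_iff, joinReducible_iff, Irr, not_and_or, or_comm]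

end ReducibleElements

theorem nonempty_orderIso_of_card_eq {A B : Type*} [PartialOrder A] [PartialOrder B] [Finite A]
    [Finite B] (hA : ∀ x y : A, x ≤ y ∨ y ≤ x) (hB : ∀ x y : B, x ≤ y ∨ y ≤ x)
    (hcard : Nat.card A = Nat.card B) : Nonempty (A ≃o B) := by
  classical
  let _ : LinearOrder A := { ‹PartialOrder A› with
    le_total := hA
    toDecidableLE := Classical.decRel _ }
  let _ : LinearOrder B := { ‹PartialOrder B› with
    le_total := hB
    toDecidableLE := Classical.decRel _ }
  cases nonempty_fintype A
  cases nonempty_fintype B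
  rw [Nat.card_eq_fintype_card] at hcard
  exact ⟨(Fintype.orderIsoFinOfCardEq A hcard).symm.trans
    (Fintype.orderIsoFinOfCardEq B Nat.card_eq_fintype_card.symm)⟩

/-- A multigraph on the linear order `K` whose edges, indexed by `E`, all point upwards. It records
how the elements outside a chain `K` of a poset are strung between members of that chain. -/
structure Skeleton (K E : Type*) [LinearOrder K] where
  lo : E → K
  hi : E → K
  lo_lt_hi (e : E) : lo e < hi e

namespace Skeleton

variable {K E : Type*} [LinearOrder K] (S : Skeleton K E)

/-- An edge spanning another edge. In a poset with skeleton `S` an essential edge must carry an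
element, since it is not a covering of its ends or duplicates another edge. -/
def Essential (e : E) : Prop := ∃ d ≠ e, S.lo e ≤ S.lo d ∧ S.hi d ≤ S.hi e

/-- Consecutive members of the chain are joined by an edge. -/
def Joined : Prop := ∀ ⦃k l : K⦄, k ⋖ l → ∃ e, S.lo e = k ∧ S.hi e = l

/-- Every member of the chain starts or ends at least two edges. This makes the chain consist of
the elements that are not doubly irreducible. -/
def Branching : Prop :=
  ∀ k, ¬ ({e | S.lo e = k}.Subsingleton ∧ {e | S.hi e = k}.Subsingleton)

/-- The skeleton with all edges reversed, describing the order dual. -/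
def dual : Skeleton Kᵒᵈ E where
  lo := OrderDual.toDual ∘ S.hi
  hi := OrderDual.toDual ∘ S.lo
  lo_lt_hi := S.lo_lt_hi

variable {S}

theorem essential_dual {e : E} : S.dual.Essential e ↔ S.Essential e := by
  simp only [Essential, and_comm (a := S.lo e ≤ _)]
  rfl

theorem Joined.dual (hS : S.Joined) : S.dual.Joined := fun _ _ hkl ↦
  (hS (toDual_covBy_toDual_iff.1 hkl)).imp fun _ h ↦ ⟨h.2, h.1⟩

theorem Joined.essential [IsStronglyAtomic K] (hS : S.Joined) {e : E} {k : K} (hlo : S.lo e < k)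
    (hhi : k < S.hi e) : S.Essential e := by
  obtain ⟨l, hl, hlk⟩ := exists_covBy_le_of_lt hlo
  obtain ⟨d, hd, rfl⟩ := hS hl
  refine ⟨d, ?_, hd.ge, (hlk.trans_lt hhi).le⟩
  rintro rfl
  exact (hlk.trans_lt hhi).ne rfl

end Skeleton

/-- A decomposition of the poset `P` into a chain of nodes, indexed by `K`, and for every edge `e`
of the skeleton `S` a chain, possibly empty, that is placed between the ends of `e`. -/
structure EdgeDecomposition {K E : Type*} [LinearOrder K] (S : Skeleton K E) (P : Type*)
    [PartialOrder P] where
  node : K ↪o P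
  edge : E → Set P
  mem_range_or_mem_edge (x : P) : x ∈ Set.range node ∨ ∃ e, x ∈ edge e
  isChain_edge (e : E) : IsChain (· ≤ ·) (edge e)
  node_le_iff {e : E} {x : P} (hx : x ∈ edge e) {k : K} : node k ≤ x ↔ k ≤ S.lo e
  le_node_iff {e : E} {x : P} (hx : x ∈ edge e) {k : K} : x ≤ node k ↔ S.hi e ≤ k
  hi_le_lo {d e : E} {x y : P} (hx : x ∈ edge d) (hy : y ∈ edge e) (hde : d ≠ e) (hxy : x ≤ y) :
    S.hi d ≤ S.lo e
  nonempty_edge {e : E} (he : S.Essential e) : (edge e).Nonempty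

namespace EdgeDecomposition

variable {K E P : Type*} [LinearOrder K] [PartialOrder P] {S : Skeleton K E}
  (D : EdgeDecomposition S P) {d e : E} {x y : P}

/-- The decomposition of the order dual. -/
def dual : EdgeDecomposition S.dual Pᵒᵈ where
  node := D.node.dual
  edge e := OrderDual.ofDual ⁻¹' D.edge e
  mem_range_or_mem_edge := D.mem_range_or_mem_edge
  isChain_edge e := (D.isChain_edge e).symm
  node_le_iff hx := D.le_node_iff hx
  le_node_iff hx := D.node_le_iff hx
  hi_le_lo hx hy hde hxy := D.hi_le_lo hy hx hde.symm hxy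
  nonempty_edge he := D.nonempty_edge (Skeleton.essential_dual.1 he)

/-- The decomposition induced on a subposet that contains the nodes and an element of every
essential edge. -/
noncomputable def comap {Q : Type*} [PartialOrder Q] (f : Q ↪o P)
    (hnode : Set.range D.node ⊆ Set.range f)
    (hedge : ∀ e, S.Essential e → (f ⁻¹' D.edge e).Nonempty) : EdgeDecomposition S Q where
  node := OrderEmbedding.ofMapLEIff (fun k ↦ (hnode ⟨k, rfl⟩).choose) fun k l ↦ by
    rw [← f.le_iff_le, (hnode ⟨k, rfl⟩).choose_spec, (hnode ⟨l, rfl⟩).choose_spec,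
      D.node.le_iff_le]
  edge e := f ⁻¹' D.edge e
  mem_range_or_mem_edge x := (D.mem_range_or_mem_edge (f x)).imp_left fun ⟨k, hk⟩ ↦
    ⟨k, f.injective ((hnode ⟨k, rfl⟩).choose_spec.trans hk)⟩
  isChain_edge e := (D.isChain_edge e).preimage _ _ _ f.injective fun _ _ ↦ f.le_iff_le.1
  node_le_iff {e x} hx k := by
    rw [← f.le_iff_le]
    exact (hnode ⟨k, rfl⟩).choose_spec.symm ▸ D.node_le_iff hx
  le_node_iff {e x} hx k := by
    rw [← f.le_iff_le]
    exact (hnode ⟨k, rfl⟩).choose_spec.symm ▸ D.le_node_iff hx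
  hi_le_lo hx hy hde hxy := D.hi_le_lo hx hy hde (f.monotone hxy)
  nonempty_edge he := hedge _ he

/-- The decomposition with the edges renamed along an equivalence. -/
def relabel {E' : Type*} {S' : Skeleton K E'} (g : E' ≃ E) (hlo : ∀ e, S.lo (g e) = S'.lo e)
    (hhi : ∀ e, S.hi (g e) = S'.hi e) : EdgeDecomposition S' P where
  node := D.node
  edge e := D.edge (g e)
  mem_range_or_mem_edge x := (D.mem_range_or_mem_edge x).imp_right fun ⟨e, he⟩ ↦
    ⟨g.symm e, by rwa [g.apply_symm_apply]⟩
  isChain_edge e := D.isChain_edge (g e)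
  node_le_iff hx _ := by rw [D.node_le_iff hx, hlo]
  le_node_iff hx _ := by rw [D.le_node_iff hx, hhi]
  hi_le_lo hx hy hde hxy := by
    rw [← hlo, ← hhi]
    exact D.hi_le_lo hx hy (g.injective.ne hde) hxy
  nonempty_edge := by
    rintro e ⟨d, hde, h⟩
    rw [← hlo, ← hlo, ← hhi, ← hhi] at h
    exact D.nonempty_edge ⟨g d, g.injective.ne hde, h⟩

section Order

theorem node_lo_lt (hx : x ∈ D.edge e) : D.node (S.lo e) < x :=
  lt_of_le_not_ge ((D.node_le_iff hx).2 le_rfl) fun h ↦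
    ((D.le_node_iff hx).1 h).not_gt (S.lo_lt_hi e)

theorem lt_node_hi (hx : x ∈ D.edge e) : x < D.node (S.hi e) :=
  D.dual.node_lo_lt hx

theorem node_notMem_edge (k : K) (e : E) : D.node k ∉ D.edge e := fun h ↦
  ((S.lo_lt_hi e).trans_le ((D.le_node_iff h).1 le_rfl)).not_ge ((D.node_le_iff h).1 le_rfl)

theorem eq_of_mem_edge (hd : x ∈ D.edge d) (he : x ∈ D.edge e) : d = e := by
  by_contra hde
  exact ((S.lo_lt_hi d).trans_le (D.hi_le_lo hd he hde le_rfl)).not_gt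
    ((S.lo_lt_hi e).trans_le (D.hi_le_lo he hd (Ne.symm hde) le_rfl))

theorem le_iff_hi_le_lo (hx : x ∈ D.edge d) (hy : y ∈ D.edge e) (hde : d ≠ e) :
    x ≤ y ↔ S.hi d ≤ S.lo e :=
  ⟨D.hi_le_lo hx hy hde, fun h ↦ (D.lt_node_hi hx).le.trans ((D.node_le_iff hy).2 h)⟩

theorem mem_edge_or_node_hi_le (hx : x ∈ D.edge e) (hxy : x ≤ y) :
    y ∈ D.edge e ∨ D.node (S.hi e) ≤ y := by
  rcases D.mem_range_or_mem_edge y with ⟨k, rfl⟩ | ⟨d, hy⟩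
  · exact Or.inr (D.node.le_iff_le.2 ((D.le_node_iff hx).1 hxy))
  · by_cases hde : e = d
    · exact Or.inl (hde ▸ hy)
    · exact Or.inr ((D.node_le_iff hy).2 (D.hi_le_lo hx hy hde hxy))

theorem mem_edge_or_le_node_lo (hx : x ∈ D.edge e) (hyx : y ≤ x) :
    y ∈ D.edge e ∨ y ≤ D.node (S.lo e) :=
  D.dual.mem_edge_or_node_hi_le hx hyx

theorem Ioo_node_subset_edge_iff [Finite P] (hS : S.Joined) :
    Set.Ioo (D.node (S.lo e)) (D.node (S.hi e)) ⊆ D.edge e ↔ ¬ S.Essential e := by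
  have : Finite K := Finite.of_injective D.node D.node.injective
  constructor
  · rintro hsub ⟨d, hde, hlo, hhi⟩
    rcases (D.edge d).eq_empty_or_nonempty with hempty | ⟨x, hx⟩
    · have node_mem (k : K) (h : S.lo e < k) (h' : k < S.hi e) : False :=
        D.node_notMem_edge k e (hsub ⟨D.node.lt_iff_lt.2 h, D.node.lt_iff_lt.2 h'⟩)
      have hlo' : S.lo e = S.lo d :=
        hlo.eq_of_not_lt fun h ↦ node_mem _ h ((S.lo_lt_hi d).trans_le hhi)
      have hhi' : S.hi d = S.hi e :=
        hhi.eq_of_not_lt fun h ↦ node_mem _ (hlo.trans_lt (S.lo_lt_hi d)) h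
      exact (D.nonempty_edge ⟨e, hde.symm, hlo'.ge, hhi'.ge⟩).ne_empty hempty
    · refine hde (D.eq_of_mem_edge hx (hsub ⟨?_, ?_⟩))
      · exact (D.node.le_iff_le.2 hlo).trans_lt (D.node_lo_lt hx)
      · exact (D.lt_node_hi hx).trans_le (D.node.le_iff_le.2 hhi)
  · rintro hess x ⟨hlo, hhi⟩
    rcases D.mem_range_or_mem_edge x with ⟨k, rfl⟩ | ⟨d, hx⟩
    · exact absurd (hS.essential (D.node.lt_iff_lt.1 hlo) (D.node.lt_iff_lt.1 hhi)) hess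
    · by_contra hxe
      refine hess ⟨d, ?_, (D.node_le_iff hx).1 hlo.le, (D.le_node_iff hx).1 hhi.le⟩
      rintro rfl
      exact hxe hx

end Order

section Covers

theorem eq_of_covBy_of_covBy (hx : x ∈ D.edge e) {y z : P} (hy : x ⋖ y) (hz : x ⋖ z) : y = z := by
  have mem_or_eq {w : P} (hw : x ⋖ w) : w ∈ D.edge e ∨ w = D.node (S.hi e) :=
    (D.mem_edge_or_node_hi_le hx hw.le).imp_right fun h ↦
      ((hw.eq_or_eq (D.lt_node_hi hx).le h).resolve_left (D.lt_node_hi hx).ne').symm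
  refine eq_of_covBy_of_le_or_le hy hz ?_
  rcases mem_or_eq hy with hye | rfl <;> rcases mem_or_eq hz with hze | rfl
  · exact (D.isChain_edge e).total hye hze
  · exact Or.inl (D.lt_node_hi hye).le
  · exact Or.inr (D.lt_node_hi hze).le
  · exact Or.inl le_rfl

theorem existsUnique_covBy_right [Finite P] (hx : x ∈ D.edge e) : ∃! z, x ⋖ z := by
  obtain ⟨z, hz, -⟩ := exists_covBy_le_of_lt (D.lt_node_hi hx)
  exact ⟨z, hz, fun y hy ↦ D.eq_of_covBy_of_covBy hx hy hz⟩

theorem existsUnique_covBy_left [Finite P] (hx : x ∈ D.edge e) : ∃! y, y ⋖ x := by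
  obtain ⟨y, hy, huniq⟩ := D.dual.existsUnique_covBy_right hx
  exact ⟨OrderDual.ofDual y, ofDual_covBy_ofDual_iff.2 hy, fun z hz ↦
    huniq (OrderDual.toDual z) (toDual_covBy_toDual_iff.2 hz)⟩

theorem irrStar_of_mem_edge [Finite P] (hx : x ∈ D.edge e) : IrrStar x :=
  ⟨D.existsUnique_covBy_left hx, D.existsUnique_covBy_right hx⟩

end Covers

section Nodes

variable [Finite P]

theorem exists_first (hS : S.Joined) (e : E) : ∃ y, D.node (S.lo e) ⋖ y ∧
    (y ∈ D.edge e ∨ D.edge e = ∅ ∧ y = D.node (S.hi e)) := by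
  rcases (D.edge e).eq_empty_or_nonempty with hempty | hne
  · refine ⟨_, covBy_iff_Ioo_eq.2 ⟨D.node.lt_iff_lt.2 (S.lo_lt_hi e), ?_⟩, Or.inr ⟨hempty, rfl⟩⟩
    rw [← Set.subset_empty_iff, ← hempty, D.Ioo_node_subset_edge_iff hS]
    exact fun hess ↦ (D.nonempty_edge hess).ne_empty hempty
  · obtain ⟨y, hy, hmin⟩ := (Set.toFinite (D.edge e)).exists_minimal hne
    refine ⟨y, ⟨D.node_lo_lt hy, fun w hw hwy ↦ ?_⟩, Or.inl hy⟩
    rcases D.mem_edge_or_le_node_lo hy hwy.le with hwe | hwlo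
    · exact hwy.not_ge (hmin hwe hwy.le)
    · exact hw.not_ge hwlo

/-- The first element after `node (lo e)` on the edge `e`; it is `node (hi e)` if the edge carries
no element. -/
noncomputable def first (hS : S.Joined) (e : E) : P := (D.exists_first hS e).choose

theorem node_lo_covBy_first (hS : S.Joined) (e : E) : D.node (S.lo e) ⋖ D.first hS e :=
  (D.exists_first hS e).choose_spec.1

theorem first_mem_edge_or (hS : S.Joined) (e : E) :
    D.first hS e ∈ D.edge e ∨ D.edge e = ∅ ∧ D.first hS e = D.node (S.hi e) :=
  (D.exists_first hS e).choose_spec.2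

theorem injOn_first (hS : S.Joined) (k : K) : Set.InjOn (D.first hS) {e | S.lo e = k} := by
  intro d hd e he hde
  rcases D.first_mem_edge_or hS d, D.first_mem_edge_or hS e with ⟨hd' | hd', he' | he'⟩
  · exact D.eq_of_mem_edge hd' (hde ▸ he')
  · exact absurd (hde.trans he'.2 ▸ hd') (D.node_notMem_edge _ d)
  · exact absurd (hde.symm.trans hd'.2 ▸ he') (D.node_notMem_edge _ e)
  · have hhi : S.hi d = S.hi e := D.node.injective (hd'.2.symm.trans (hde.trans he'.2))
    by_contra hne
    exact (D.nonempty_edge ⟨e, Ne.symm hne, (hd.trans he.symm).le, hhi.ge⟩).ne_empty hd'.1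

theorem surjOn_first (hS : S.Joined) (k : K) :
    Set.SurjOn (D.first hS) {e | S.lo e = k} {y | D.node k ⋖ y} := by
  rintro y (hy : D.node k ⋖ y)
  rcases D.mem_range_or_mem_edge y with ⟨l, rfl⟩ | ⟨e, hye⟩
  · have hkl : k ⋖ l := ⟨D.node.lt_iff_lt.1 hy.lt, fun m hkm hml ↦
      hy.2 (D.node.lt_iff_lt.2 hkm) (D.node.lt_iff_lt.2 hml)⟩
    obtain ⟨e, rfl, rfl⟩ := hS hkl
    rcases D.first_mem_edge_or hS e with he | he
    · exact absurd (D.lt_node_hi he) (hy.2 (D.node_lo_lt he))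
    · exact ⟨e, rfl, he.2⟩
  · obtain rfl : k = S.lo e := by
      refine ((D.node_le_iff hye).1 hy.le).eq_of_not_lt fun h ↦ ?_
      exact hy.2 (D.node.lt_iff_lt.2 h) (D.node_lo_lt hye)
    refine ⟨e, rfl, eq_of_covBy_of_le_or_le (D.node_lo_covBy_first hS e) hy ?_⟩
    rcases D.first_mem_edge_or hS e with he | he
    · exact (D.isChain_edge e).total he hye
    · exact absurd (he.1 ▸ hye) (Set.notMem_empty y)

theorem bijOn_first (hS : S.Joined) (k : K) :
    Set.BijOn (D.first hS) {e | S.lo e = k} {y | D.node k ⋖ y} :=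
  ⟨fun e he ↦ he ▸ D.node_lo_covBy_first hS e, D.injOn_first hS k, D.surjOn_first hS k⟩

theorem subsingleton_setOf_node_covBy (hS : S.Joined) (k : K) :
    {y | D.node k ⋖ y}.Subsingleton ↔ {e | S.lo e = k}.Subsingleton := by
  rw [← (D.bijOn_first hS k).image_eq]
  exact ⟨fun h _ hd _ he ↦ D.injOn_first hS k hd he (h ⟨_, hd, rfl⟩ ⟨_, he, rfl⟩),
    fun h ↦ h.image _⟩

theorem subsingleton_setOf_covBy_node (hS : S.Joined) (k : K) :
    {y | y ⋖ D.node k}.Subsingleton ↔ {e | S.hi e = k}.Subsingleton :=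
  subsingleton_setOf_toDual_covBy.symm.trans
    (D.dual.subsingleton_setOf_node_covBy hS.dual (OrderDual.toDual k))

theorem irr_node_iff (hS : S.Joined) (k : K) : Irr (D.node k) ↔
    {e | S.lo e = k}.Subsingleton ∧ {e | S.hi e = k}.Subsingleton := by
  rw [Irr, D.subsingleton_setOf_covBy_node hS, D.subsingleton_setOf_node_covBy hS, and_comm]

theorem not_irr_iff (hS : S.Joined) (hS' : S.Branching) : ¬ Irr x ↔ x ∈ Set.range D.node := by
  constructor
  · intro hx
    refine (D.mem_range_or_mem_edge x).resolve_right fun ⟨e, he⟩ ↦ ?_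
    exact hx (D.irrStar_of_mem_edge he).irr
  · rintro ⟨k, rfl⟩
    rw [D.irr_node_iff hS]
    exact hS' k

theorem not_pendant (D : EdgeDecomposition S P) (hS : S.Joined) (hS' : S.Branching) (x : P) :
    ¬ Pendant x := by
  rcases D.mem_range_or_mem_edge x with hx | ⟨e, hx⟩
  · exact not_pendant_of_not_irr ((D.not_irr_iff hS hS').2 hx)
  · exact not_pendant_of_irrStar (D.irrStar_of_mem_edge hx)

theorem nullity_eq (D : EdgeDecomposition S P) [Finite E] (hS : S.Joined) {b : P} (hb : IsBot b) :
    nullity P = Nat.card E - Nat.card K + 1 := by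
  have : Finite K := Finite.of_injective D.node D.node.injective
  cases nonempty_fintype P
  cases nonempty_fintype K
  have hedge (x : P) (hx : x ∉ Set.range D.node) : (({z | x ⋖ z}.ncard : ℤ) - 1) = 0 := by
    obtain ⟨e, he⟩ := (D.mem_range_or_mem_edge x).resolve_left hx
    obtain ⟨z, hz, huniq⟩ := D.existsUnique_covBy_right he
    have hcovers : {z | x ⋖ z} = {z} := Set.eq_singleton_iff_unique_mem.2 ⟨hz, huniq⟩
    rw [hcovers, Set.ncard_singleton, Nat.cast_one, sub_self]
  have hnode (k : K) : (({e | S.lo e = k}.ncard : ℤ) - 1) = ({z | D.node k ⋖ z}.ncard : ℤ) - 1 := by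
    rw [(D.bijOn_first hS k).ncard_eq]
  have hcard : Nat.card E = ∑ k, {e | S.lo e = k}.ncard := by
    rw [← Nat.card_congr (Equiv.sigmaFiberEquiv S.lo), Nat.card_sigma]
    rfl
  rw [nullity_eq_sum hb, ← Fintype.sum_of_injective D.node D.node.injective _ _ hedge hnode, hcard]
  simp

end Nodes

section Cardinality

/-- The elements of `P` are the nodes and the elements of the edges. -/
noncomputable def equivSum : K ⊕ (Σ e, D.edge e) ≃ P :=
  Equiv.ofBijective (Sum.elim D.node fun x ↦ x.2) <| by
    constructor
    · rintro (k | ⟨d, x, hx⟩) (l | ⟨e, y, hy⟩) h <;> simp only [Sum.elim_inl, Sum.elim_inr] at h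
      · exact congrArg Sum.inl (D.node.injective h)
      · exact absurd (h ▸ hy) (D.node_notMem_edge k e)
      · exact absurd (h ▸ hx) (D.node_notMem_edge l d)
      · subst h
        obtain rfl := D.eq_of_mem_edge hx hy
        rfl
    · intro x
      rcases D.mem_range_or_mem_edge x with ⟨k, rfl⟩ | ⟨e, hx⟩
      · exact ⟨.inl k, rfl⟩
      · exact ⟨.inr ⟨e, x, hx⟩, rfl⟩

/-- The number of elements on each edge. -/
noncomputable def size (e : E) : ℕ := (D.edge e).ncard

theorem card_eq [Finite P] [Fintype E] : Nat.card P = Nat.card K + ∑ e, D.size e := by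
  have : Finite K := Finite.of_injective D.node D.node.injective
  rw [← Nat.card_congr D.equivSum, Nat.card_sum, Nat.card_sigma]
  rfl

theorem exists_size_eq_of_orderIso {Q : Type*} [PartialOrder Q] (g : Q ≃o P) :
    ∃ D' : EdgeDecomposition S Q, D'.size = D.size := by
  have hpreimage (s : Set P) : (g ⁻¹' s).ncard = s.ncard :=
    Set.ncard_preimage_of_injective_subset_range g.injective (by simp [g.surjective.range_eq])
  exact ⟨D.comap g.toOrderEmbedding (fun x _ ↦ g.surjective x)
    (fun e he ↦ (D.nonempty_edge he).preimage g.surjective), funext fun e ↦ hpreimage _⟩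

theorem nonempty_orderIso_of_size_eq {Q : Type*} [PartialOrder Q] [Finite P] [Finite Q]
    (D' : EdgeDecomposition S Q) (hsize : D.size = D'.size) : Nonempty (P ≃o Q) := by
  have hiso (e : E) : Nonempty (D.edge e ≃o D'.edge e) :=
    nonempty_orderIso_of_card_eq (fun x y ↦ (D.isChain_edge e).total x.2 y.2)
      (fun x y ↦ (D'.isChain_edge e).total x.2 y.2) (congrFun hsize e)
  let g (e : E) := (hiso e).some
  let φ := Equiv.sumCongr (Equiv.refl K) (Equiv.sigmaCongrRight fun e ↦ (g e).toEquiv)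
  have hφ (a b) : D'.equivSum (φ a) ≤ D'.equivSum (φ b) ↔ D.equivSum a ≤ D.equivSum b := by
    rcases a with k | ⟨d, x, hx⟩ <;> rcases b with l | ⟨e, y, hy⟩
    · exact D'.node.le_iff_le.trans D.node.le_iff_le.symm
    · exact (D'.node_le_iff (g e ⟨y, hy⟩).2).trans (D.node_le_iff hy).symm
    · exact (D'.le_node_iff (g d ⟨x, hx⟩).2).trans (D.le_node_iff hx).symm
    · by_cases hde : d = e
      · subst hde
        exact (g d).le_iff_le
      · exact (D'.le_iff_hi_le_lo (g d ⟨x, hx⟩).2 (g e ⟨y, hy⟩).2 hde).trans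
          (D.le_iff_hi_le_lo hx hy hde).symm
  exact ⟨{ toEquiv := D.equivSum.symm.trans (φ.trans D'.equivSum)
           map_rel_iff' := fun {x y} ↦ (hφ (D.equivSum.symm x) (D.equivSum.symm y)).trans <| by
            rw [D.equivSum.apply_symm_apply, D.equivSum.apply_symm_apply] }⟩

end Cardinality

variable {z : P}

section Retractible

theorem edge_eq_singleton_of_covBy (hx : x ∈ D.edge e) (hlo : D.node (S.lo e) ⋖ x)
    (hhi : x ⋖ D.node (S.hi e)) : D.edge e = {x} := by
  refine Set.eq_singleton_iff_unique_mem.2 ⟨hx, fun w hw ↦ ?_⟩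
  rcases (D.isChain_edge e).total hw hx with h | h
  · exact (hlo.eq_or_eq (D.node_lo_lt hw).le h).resolve_left (D.node_lo_lt hw).ne'
  · exact (hhi.eq_or_eq h (D.lt_node_hi hw).le).resolve_right (D.lt_node_hi hw).ne

theorem node_lo_covBy_of_edge_eq_singleton (hx : D.edge e = {x}) : D.node (S.lo e) ⋖ x := by
  have hxe : x ∈ D.edge e := hx ▸ rfl
  refine ⟨D.node_lo_lt hxe, fun w hw hwx ↦ ?_⟩
  rcases D.mem_edge_or_le_node_lo hxe hwx.le with hwe | hwlo
  · rw [hx] at hwe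
    exact hwx.ne hwe
  · exact hw.not_ge hwlo

theorem covBy_node_hi_of_edge_eq_singleton (hx : D.edge e = {x}) : x ⋖ D.node (S.hi e) :=
  ofDual_covBy_ofDual_iff.2 (D.dual.node_lo_covBy_of_edge_eq_singleton hx)

variable [Finite P]

theorem eq_node_lo_of_covBy (hS : S.Joined) (hS' : S.Branching) (hx : x ∈ D.edge e)
    (hyx : y ⋖ x) (hy : ¬ Irr y) : y = D.node (S.lo e) := by
  obtain ⟨k, rfl⟩ := (D.not_irr_iff hS hS').1 hy
  have hk : D.node k ≤ D.node (S.lo e) := D.node.le_iff_le.2 ((D.node_le_iff hx).1 hyx.le)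
  exact ((hyx.eq_or_eq hk (D.node_lo_lt hx).le).resolve_right (D.node_lo_lt hx).ne).symm

theorem eq_node_hi_of_covBy (hS : S.Joined) (hS' : S.Branching) (hx : x ∈ D.edge e)
    (hxz : x ⋖ z) (hz : ¬ Irr z) : z = D.node (S.hi e) := by
  obtain ⟨k, rfl⟩ := (D.not_irr_iff hS hS').1 hz
  have hk : D.node (S.hi e) ≤ D.node k := D.node.le_iff_le.2 ((D.le_node_iff hx).1 hxz.le)
  exact ((hxz.eq_or_eq (D.lt_node_hi hx).le hk).resolve_left (D.lt_node_hi hx).ne').symm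

theorem retractible_iff (hS : S.Joined) (hS' : S.Branching) (hx : x ∈ D.edge e) :
    Retractible x ↔ (D.edge e).Nontrivial ∨ ¬ S.Essential e := by
  have hirr : Irr x := (D.irrStar_of_mem_edge hx).irr
  have not_irr_node (k : K) : ¬ Irr (D.node k) := (D.not_irr_iff hS hS').2 ⟨k, rfl⟩
  rw [Retractible, and_iff_right hirr]
  by_cases hne : (D.edge e).Nontrivial
  · refine iff_of_true (Or.inl ?_) (Or.inl hne)
    rintro ⟨y, z, hy, hz, hyx, hxz⟩
    obtain rfl := D.eq_node_lo_of_covBy hS hS' hx hyx hy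
    obtain rfl := D.eq_node_hi_of_covBy hS hS' hx hxz hz
    exact hne.ne_singleton (D.edge_eq_singleton_of_covBy hx hyx hxz)
  · have hedge : D.edge e = {x} := (Set.not_nontrivial_iff.1 hne).eq_singleton_of_mem hx
    have hlo := D.node_lo_covBy_of_edge_eq_singleton hedge
    have hhi := D.covBy_node_hi_of_edge_eq_singleton hedge
    rw [or_iff_right hne, ← D.Ioo_node_subset_edge_iff hS, hedge,
      ← Ioo_subset_singleton_iff_forall_isChain hlo hhi, or_iff_right]
    · constructor
      · rintro ⟨y, z, hy, hz, hyx, hxz, hpath⟩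
        obtain rfl := D.eq_node_lo_of_covBy hS hS' hx hyx hy
        obtain rfl := D.eq_node_hi_of_covBy hS hS' hx hxz hz
        exact hpath
      · exact fun hpath ↦
          ⟨_, _, not_irr_node (S.lo e), not_irr_node (S.hi e), hlo, hhi, hpath⟩
    · exact not_not_intro ⟨_, _, not_irr_node (S.lo e), not_irr_node (S.hi e), hlo, hhi⟩

end Retractible

section BasicBlock

variable [Finite P] {T T' R : Set P}

theorem nonempty_of_retractStep (hS : S.Joined) (hS' : S.Branching) (D : EdgeDecomposition S T)
    (h : RetractStep T T') : Nonempty (EdgeDecomposition S T') := by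
  obtain ⟨x, hirr, hretr, rfl⟩ := h
  have hx : x ∉ Set.range D.node := fun hx ↦ (D.not_irr_iff hS hS').2 hx hirr.irr
  obtain ⟨e, hxe⟩ := (D.mem_range_or_mem_edge x).resolve_left hx
  have survives {y : T} (hy : y ≠ x) : (y : P) ∈ T \ {(x : P)} :=
    ⟨y.2, fun h ↦ hy (Subtype.ext h)⟩
  refine ⟨D.comap (Subtype.orderEmbedding fun _ h ↦ h.1) ?_ fun d hd ↦ ?_⟩
  · rintro _ ⟨k, rfl⟩
    exact ⟨⟨D.node k, survives fun h ↦ hx ⟨k, h⟩⟩, rfl⟩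
  · obtain ⟨y, hy, hyx⟩ : ∃ y ∈ D.edge d, y ≠ x := by
      rcases (D.retractible_iff hS hS' hxe).1 hretr with hne | hess
      · by_cases hde : d = e
        · exact hde ▸ hne.exists_ne x
        · obtain ⟨y, hy⟩ := D.nonempty_edge hd
          exact ⟨y, hy, fun h ↦ hde (D.eq_of_mem_edge hy (h ▸ hxe))⟩
      · obtain ⟨y, hy⟩ := D.nonempty_edge hd
        exact ⟨y, hy, fun h ↦ hess (D.eq_of_mem_edge hy (h ▸ hxe) ▸ hd)⟩
    exact ⟨⟨y, survives hyx⟩, hy⟩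

theorem nonempty_of_reflTransGen_retractStep (hS : S.Joined) (hS' : S.Branching)
    (D : EdgeDecomposition S P) (h : Relation.ReflTransGen RetractStep Set.univ R) :
    Nonempty (EdgeDecomposition S R) := by
  induction h with
  | refl =>
    let φ : (Set.univ : Set P) ≃o P := OrderIso.Set.univ
    exact ⟨D.comap φ.toOrderEmbedding (fun y _ ↦ φ.surjective y)
      fun e he ↦ (D.nonempty_edge he).preimage φ.surjective⟩
  | tail _ h ih =>
    obtain ⟨D'⟩ := ih
    exact D'.nonempty_of_retractStep hS hS' h

open Classical in
theorem size_eq_of_forall_not_retractible (hS : S.Joined) (hS' : S.Branching)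
    (h : ∀ x : P, IrrStar x → ¬ Retractible x) :
    D.size = fun e ↦ if S.Essential e then 1 else 0 := by
  funext e
  have not_retractible {x : P} (hx : x ∈ D.edge e) :
      ¬ (D.edge e).Nontrivial ∧ S.Essential e := by
    simpa only [D.retractible_iff hS hS' hx, not_or, not_not] using h x (D.irrStar_of_mem_edge hx)
  split_ifs with hess
  · obtain ⟨x, hx⟩ := D.nonempty_edge hess
    have hsub := Set.not_nontrivial_iff.1 (not_retractible hx).1
    exact Set.ncard_eq_one.2 ⟨x, hsub.eq_singleton_of_mem hx⟩
  · have hempty : D.edge e = ∅ :=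
      Set.eq_empty_of_forall_notMem fun x hx ↦ hess (not_retractible hx).2
    rw [size, hempty, Set.ncard_empty]

theorem eq_of_reflTransGen_pendantStep (hS : S.Joined) (hS' : S.Branching)
    (D : EdgeDecomposition S R) {B : Set P} (h : Relation.ReflTransGen PendantStep R B) :
    B = R := by
  rcases Relation.ReflTransGen.cases_head h with rfl | ⟨_, ⟨x, hx, -⟩, -⟩
  · rfl
  · exact absurd hx (D.not_pendant hS hS' x)

open Classical in
theorem exists_size_eq_of_isBasicBlockOf (hS : S.Joined) (hS' : S.Branching)
    (D : EdgeDecomposition S P) {B : Set P} (hB : IsBasicBlockOf B) :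
    ∃ D' : EdgeDecomposition S B, D'.size = fun e ↦ if S.Essential e then 1 else 0 := by
  obtain ⟨R, ⟨hR, hretr⟩, hpendant, -⟩ := hB
  obtain ⟨D'⟩ := D.nonempty_of_reflTransGen_retractStep hS hS' hR
  obtain rfl := D'.eq_of_reflTransGen_pendantStep hS hS' hpendant
  exact ⟨D', D'.size_eq_of_forall_not_retractible hS hS' hretr⟩

theorem exists_isBasicBlockOf (D : EdgeDecomposition S P) (hS : S.Joined) (hS' : S.Branching) :
    ∃ B : Set P, IsBasicBlockOf B := by
  obtain ⟨R, hR, hmin⟩ :=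
    (Set.toFinite {R : Set P | Relation.ReflTransGen RetractStep Set.univ R}).exists_minimal
      ⟨_, .refl⟩
  obtain ⟨D'⟩ := D.nonempty_of_reflTransGen_retractStep hS hS' hR
  refine ⟨R, R, ⟨hR, fun x hirr hretr ↦ ?_⟩, .refl, D'.not_pendant hS hS'⟩
  exact (hmin (hR.tail ⟨x, hirr, hretr, rfl⟩) Set.sdiff_subset x.2).2 rfl

end BasicBlock

section Uniqueness

variable {E' : Type*} {S' : Skeleton K E'} (D' : EdgeDecomposition S' P) {e' : E'}

theorem node_eq_node [Finite P] (hS : S.Joined) (hSb : S.Branching) (hS' : S'.Joined)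
    (hSb' : S'.Branching) : D.node = D'.node := by
  have : Finite K := Finite.of_injective D.node D.node.injective
  refine OrderEmbedding.range_inj.1 (Set.ext fun x ↦ ?_)
  rw [← D.not_irr_iff hS hSb, ← D'.not_irr_iff hS' hSb']

variable {D D'}

theorem lo_eq_lo_of_node_eq (hnode : D.node = D'.node) (hx : x ∈ D.edge e) (hx' : x ∈ D'.edge e') :
    S.lo e = S'.lo e' :=
  eq_of_forall_le_iff fun k ↦ by rw [← D.node_le_iff hx, hnode, D'.node_le_iff hx']

theorem hi_eq_hi_of_node_eq (hnode : D.node = D'.node) (hx : x ∈ D.edge e) (hx' : x ∈ D'.edge e') :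
    S.hi e = S'.hi e' :=
  eq_of_forall_ge_iff fun k ↦ by rw [← D.le_node_iff hx, hnode, D'.le_node_iff hx']

theorem edge_subset_edge_of_node_eq (hnode : D.node = D'.node) (hx : x ∈ D.edge e)
    (hx' : x ∈ D'.edge e') : D.edge e ⊆ D'.edge e' := by
  intro y hy
  obtain ⟨d', hy'⟩ := (D'.mem_range_or_mem_edge y).resolve_left <| by
    rintro ⟨k, rfl⟩
    exact D.node_notMem_edge k e (hnode ▸ hy)
  by_contra hye
  have hne : d' ≠ e' := by
    rintro rfl
    exact hye hy'
  rcases (D.isChain_edge e).total hx hy with h | h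
  · have := D'.hi_le_lo hx' hy' hne.symm h
    rw [← hi_eq_hi_of_node_eq hnode hx hx', ← lo_eq_lo_of_node_eq hnode hy hy'] at this
    exact this.not_gt (S.lo_lt_hi e)
  · have := D'.hi_le_lo hy' hx' hne h
    rw [← hi_eq_hi_of_node_eq hnode hy hy', ← lo_eq_lo_of_node_eq hnode hx hx'] at this
    exact this.not_gt (S.lo_lt_hi e)

theorem edge_eq_edge_of_node_eq (hnode : D.node = D'.node) (hx : x ∈ D.edge e)
    (hx' : x ∈ D'.edge e') : D.edge e = D'.edge e' :=
  (edge_subset_edge_of_node_eq hnode hx hx').antisymm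
    (edge_subset_edge_of_node_eq hnode.symm hx' hx)

end Uniqueness

end EdgeDecomposition

section CoverSkeleton

variable {K P : Type*} [LinearOrder K] [PartialOrder P] {r : K ↪o P} {lo hi : P → K}

/-- The skeleton whose edges are the coverings that start in a chain `r`; such an edge leads from
its start to the least member of the chain above. -/
def coverSkeleton (hhi : GaloisConnection hi r) : Skeleton K {q : K × P // r q.1 ⋖ q.2} where
  lo q := q.1.1
  hi q := hi q.1.2
  lo_lt_hi q := r.lt_iff_lt.1 (q.2.lt.trans_le (hhi.le_u_l q.1.2))

/-- The doubly irreducible elements strung on the edge of `coverSkeleton` that starts with the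
covering `q`. -/
def coverEdge (lo : P → K) (q : {q : K × P // r q.1 ⋖ q.2}) : Set P :=
  {x | Irr x ∧ lo x = q.1.1 ∧ q.1.2 ≤ x}

theorem lo_eq_of_covBy (hlo : GaloisConnection r lo) (hr : ∀ x, ¬ Irr x ↔ x ∈ Set.range r) {k : K}
    {y : P} (hky : r k ⋖ y) (hy : Irr y) : lo y = k := by
  refine (((hlo k y).1 hky.le).eq_of_not_lt fun h ↦ ?_).symm
  have hne : r (lo y) ≠ y := fun h ↦ (hr y).2 ⟨_, h⟩ hy
  exact hky.2 (r.lt_iff_lt.2 h) ((hlo.l_u_le y).lt_of_ne hne)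

theorem irr_of_lt_of_le (hlo : GaloisConnection r lo) (hr : ∀ x, ¬ Irr x ↔ x ∈ Set.range r)
    {w x : P} (hw : r (lo x) < w) (hwx : w ≤ x) : Irr w := by
  by_contra hirr
  obtain ⟨k, rfl⟩ := (hr w).1 hirr
  exact hw.not_ge (r.le_iff_le.2 ((hlo k x).1 hwx))

theorem exists_mem_coverEdge [Finite P] (hlo : GaloisConnection r lo)
    (hr : ∀ x, ¬ Irr x ↔ x ∈ Set.range r) {x : P} (hx : Irr x) :
    ∃ q : {q : K × P // r q.1 ⋖ q.2}, x ∈ coverEdge lo q := by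
  have hne : r (lo x) ≠ x := fun h ↦ (hr x).2 ⟨_, h⟩ hx
  obtain ⟨y, hy, hyx⟩ := exists_covBy_le_of_lt ((hlo.l_u_le x).lt_of_ne hne)
  exact ⟨⟨(lo x, y), hy⟩, hx, rfl, hyx⟩

theorem irr_of_mem_coverEdge (hlo : GaloisConnection r lo) (hr : ∀ x, ¬ Irr x ↔ x ∈ Set.range r)
    {q : {q : K × P // r q.1 ⋖ q.2}} {w x : P} (hx : x ∈ coverEdge lo q)
    (hw : w ∈ Set.Icc q.1.2 x) : Irr w :=
  irr_of_lt_of_le hlo hr (hx.2.1 ▸ q.2.lt.trans_le hw.1) hw.2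

theorem mem_coverEdge_of_essential (hlo : GaloisConnection r lo) (hhi : GaloisConnection hi r)
    (hr : ∀ x, ¬ Irr x ↔ x ∈ Set.range r) {q : {q : K × P // r q.1 ⋖ q.2}}
    (hq : (coverSkeleton hhi).Essential q) : q.1.2 ∈ coverEdge lo q := by
  suffices hirr : Irr q.1.2 from ⟨hirr, lo_eq_of_covBy hlo hr q.2 hirr, le_rfl⟩
  by_contra hirr
  obtain ⟨m, hm⟩ := (hr _).1 hirr
  obtain ⟨q', hne, hlo_le, hhi_le⟩ := hq
  have hle : q'.1.2 ≤ q.1.2 := by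
    rw [← hm]
    exact (hhi _ _).1 (hhi_le.trans ((hhi _ _).2 hm.ge))
  have hle' : r q.1.1 ≤ r q'.1.1 := r.le_iff_le.2 hlo_le
  refine hne (Subtype.ext (Prod.ext (r.injective ?_) ?_))
  · exact (q.2.eq_or_eq hle' (q'.2.le.trans hle)).resolve_right (q'.2.lt.trans_le hle).ne
  · exact (q.2.eq_or_eq (hle'.trans q'.2.le) hle).resolve_left (hle'.trans_lt q'.2.lt).ne'

variable [Finite P]

theorem hi_eq_of_mem_coverEdge (hlo : GaloisConnection r lo) (hhi : GaloisConnection hi r)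
    (hr : ∀ x, ¬ Irr x ↔ x ∈ Set.range r) {q : {q : K × P // r q.1 ⋖ q.2}} {x : P}
    (hx : x ∈ coverEdge lo q) : hi x = hi q.1.2 := by
  refine ((hhi _ _).2 ?_).antisymm (hhi.monotone_l hx.2.2)
  refine (le_or_le_of_forall_irr_of_ge hx.2.2 (hhi.le_u_l _) fun w ↦
    irr_of_mem_coverEdge hlo hr hx).resolve_right fun h ↦ ?_
  exact (hr _).2 ⟨_, rfl⟩ (irr_of_mem_coverEdge hlo hr hx ⟨hhi.le_u_l _, h⟩)

theorem hi_le_lo_of_mem_coverEdge (hlo : GaloisConnection r lo) (hhi : GaloisConnection hi r)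
    (hr : ∀ x, ¬ Irr x ↔ x ∈ Set.range r) {q q' : {q : K × P // r q.1 ⋖ q.2}} {x x' : P}
    (hx : x ∈ coverEdge lo q) (hx' : x' ∈ coverEdge lo q') (hne : q ≠ q') (hxx' : x ≤ x') :
    hi x ≤ lo x' := by
  rw [hhi]
  by_contra hx_le
  have hirr (w : P) (hw : w ∈ Set.Icc x x') : Irr w := by
    by_contra hirr
    obtain ⟨k, rfl⟩ := (hr w).1 hirr
    exact hx_le (hw.1.trans (r.le_iff_le.2 ((hlo k x').1 hw.2)))
  have hlo_le : r (lo x') ≤ x :=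
    (le_or_le_of_forall_irr_of_le hxx' (hlo.l_u_le x') hirr).resolve_left hx_le
  have hlo_eq : q.1.1 = q'.1.1 :=
    hx.2.1.symm.trans (((hlo.monotone_u hxx').antisymm ((hlo _ _).1 hlo_le)).trans hx'.2.1)
  refine hne (Subtype.ext (Prod.ext hlo_eq (eq_of_covBy_of_le_or_le q.2 (hlo_eq ▸ q'.2) ?_)))
  refine le_or_le_of_forall_irr_of_le (hx.2.2.trans hxx') hx'.2.2 fun w hw ↦ ?_
  refine irr_of_lt_of_le hlo hr ?_ hw.2
  exact (hx'.2.1.trans hlo_eq.symm ▸ q.2.lt).trans_le hw.1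

/-- The decomposition of a finite poset in which the elements that are not doubly irreducible form
a chain `r` whose greatest member below and least member above each element exist. -/
def coverDecomposition (hlo : GaloisConnection r lo) (hhi : GaloisConnection hi r)
    (hr : ∀ x, ¬ Irr x ↔ x ∈ Set.range r) : EdgeDecomposition (coverSkeleton hhi) P where
  node := r
  edge := coverEdge lo
  mem_range_or_mem_edge x := by
    rw [← hr, or_iff_not_imp_left, not_not]
    exact exists_mem_coverEdge hlo hr
  isChain_edge q x hx x' hx' _ :=
    le_or_le_of_forall_irr_of_ge hx.2.2 hx'.2.2 fun _ ↦ irr_of_mem_coverEdge hlo hr hx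
  node_le_iff hx k := (hlo k _).trans (by rw [hx.2.1]; rfl)
  le_node_iff hx k := (hhi _ k).symm.trans (hi_eq_of_mem_coverEdge hlo hhi hr hx ▸ Iff.rfl)
  hi_le_lo hx hx' hne hxx' := by
    have := hi_le_lo_of_mem_coverEdge hlo hhi hr hx hx' hne hxx'
    rwa [hi_eq_of_mem_coverEdge hlo hhi hr hx, hx'.2.1] at this
  nonempty_edge hq := ⟨_, mem_coverEdge_of_essential hlo hhi hr hq⟩

theorem joined_coverSkeleton (hhi : GaloisConnection hi r) : (coverSkeleton hhi).Joined := by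
  intro k l hkl
  obtain ⟨y, hy, hyl⟩ := exists_covBy_le_of_lt (r.lt_iff_lt.2 hkl.lt)
  have hk : k < hi y := (coverSkeleton hhi).lo_lt_hi ⟨(k, y), hy⟩
  exact ⟨⟨(k, y), hy⟩, rfl, (hkl.eq_or_eq hk.le ((hhi y l).2 hyl)).resolve_left hk.ne'⟩

end CoverSkeleton

section AdjunctSkeleton

variable {n : ℕ} {ι P : Type*}

/-- The skeleton of a chain of length `n` to which, for every `c`, a further edge is attached at the
adjunct pair `p c`. -/
def adjunctSkeleton (p : ι → {q : Fin (n + 1) × Fin (n + 1) // q.1 < q.2}) :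
    Skeleton (Fin (n + 1)) (Fin n ⊕ ι) where
  lo := Sum.elim Fin.castSucc fun c ↦ (p c).1.1
  hi := Sum.elim Fin.succ fun c ↦ (p c).1.2
  lo_lt_hi
    | .inl _ => Fin.castSucc_lt_succ
    | .inr c => (p c).2

/-- No adjunct pair consists of consecutive members of the chain. A one-element chain attached at
such a pair would lengthen the chain. -/
def Wide (p : ι → {q : Fin (n + 1) × Fin (n + 1) // q.1 < q.2}) : Prop :=
  ∀ c, ((p c).1.1 : ℕ) + 1 < (p c).1.2

theorem joined_adjunctSkeleton (p : ι → {q : Fin (n + 1) × Fin (n + 1) // q.1 < q.2}) :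
    (adjunctSkeleton p).Joined := by
  intro k l hkl
  obtain ⟨m, rfl⟩ := Fin.exists_castSucc_eq.2 (Fin.ne_last_of_lt hkl.lt)
  exact ⟨.inl m, rfl, Fin.ext (Nat.covBy_iff_add_one_eq.1 (Fin.covBy_iff.1 hkl))⟩

variable {p : ι → {q : Fin (n + 1) × Fin (n + 1) // q.1 < q.2}}

theorem subsingleton_setOf_lo_adjunctSkeleton_eq {k : Fin (n + 1)} :
    {e | (adjunctSkeleton p).lo e = k}.Subsingleton ↔ ∀ c, (p c).1.1 ≠ k := by
  constructor
  · rintro h c rfl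
    obtain ⟨m, hm⟩ := Fin.exists_castSucc_eq.2 (Fin.ne_last_of_lt (p c).2)
    exact Sum.inl_ne_inr (h (show Sum.inl m ∈ _ from hm) (show Sum.inr c ∈ _ from rfl))
  · rintro h (a | c) ha (b | d) hb
    · exact congrArg Sum.inl (Fin.castSucc_injective n (ha.trans hb.symm))
    · exact absurd hb (h d)
    · exact absurd ha (h c)
    · exact absurd ha (h c)

theorem subsingleton_setOf_hi_adjunctSkeleton_eq {k : Fin (n + 1)} :
    {e | (adjunctSkeleton p).hi e = k}.Subsingleton ↔ ∀ c, (p c).1.2 ≠ k := by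
  constructor
  · rintro h c rfl
    obtain ⟨m, hm⟩ := Fin.exists_succ_eq.2 (Fin.ne_zero_of_lt (p c).2)
    exact Sum.inl_ne_inr (h (show Sum.inl m ∈ _ from hm) (show Sum.inr c ∈ _ from rfl))
  · rintro h (a | c) ha (b | d) hb
    · exact congrArg Sum.inl (Fin.succ_injective n (ha.trans hb.symm))
    · exact absurd hb (h d)
    · exact absurd ha (h c)
    · exact absurd ha (h c)

theorem branching_adjunctSkeleton_iff :
    (adjunctSkeleton p).Branching ↔ ∀ k, ∃ c, (p c).1.1 = k ∨ (p c).1.2 = k := by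
  simp only [Skeleton.Branching, subsingleton_setOf_lo_adjunctSkeleton_eq,
    subsingleton_setOf_hi_adjunctSkeleton_eq, ← not_exists, ← not_or, not_not,
    exists_or]

theorem essential_inr (p : ι → {q : Fin (n + 1) × Fin (n + 1) // q.1 < q.2}) (c : ι) :
    (adjunctSkeleton p).Essential (.inr c) := by
  obtain ⟨m, hm⟩ := Fin.exists_castSucc_eq.2 (Fin.ne_last_of_lt (p c).2)
  exact ⟨.inl m, Sum.inl_ne_inr, hm.ge, Fin.castSucc_lt_iff_succ_le.1 (hm ▸ (p c).2)⟩

theorem Wide.not_essential_inl (hp : Wide p) (k : Fin n) :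
    ¬ (adjunctSkeleton p).Essential (.inl k) := by
  rintro ⟨d | c, hne, hlo, hhi⟩
  · exact hne (congrArg Sum.inl (le_antisymm (Fin.succ_le_succ_iff.1 hhi) hlo))
  · have hlo' : (k : ℕ) ≤ (p c).1.1 := hlo
    have hhi' : ((p c).1.2 : ℕ) ≤ k + 1 := hhi
    have := hp c
    omega

theorem wide_of_krullDim_le [PartialOrder P] (D : EdgeDecomposition (adjunctSkeleton p) P)
    (h : Order.krullDim P ≤ n) : Wide p := by
  intro c
  by_contra hc
  obtain ⟨m, hm⟩ := Fin.exists_castSucc_eq.2 (Fin.ne_last_of_lt (p c).2)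
  have hm' : (p c).1.2 = m.succ := by
    have hlt : ((p c).1.1 : ℕ) < (p c).1.2 := (p c).2
    have hval : (m : ℕ) = (p c).1.1 := congrArg Fin.val hm
    exact Fin.ext (by rw [Fin.val_succ]; omega)
  obtain ⟨x, hx⟩ := D.nonempty_edge (essential_inr p c)
  let nodes : LTSeries P := ⟨n, D.node, fun _ ↦ D.node.strictMono Fin.castSucc_lt_succ⟩
  let longer : LTSeries P := nodes.insertNth m x (hm.symm ▸ D.node_lo_lt hx)
    (hm' ▸ D.lt_node_hi hx)
  have hlonger : ((n + 1 : ℕ) : WithBot ℕ∞) ≤ n :=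
    (Order.LTSeries.length_le_krullDim longer).trans h
  exact absurd (Nat.cast_le.1 (WithBot.coe_le_coe.1 hlonger)) (Nat.not_succ_le_self n)

theorem EdgeDecomposition.exists_size_eq_comp_sumMap [PartialOrder P]
    {p' : ι → {q : Fin (n + 1) × Fin (n + 1) // q.1 < q.2}}
    (D : EdgeDecomposition (adjunctSkeleton p) P) (σ : Equiv.Perm ι) (hσ : ∀ c, p (σ c) = p' c) :
    ∃ D' : EdgeDecomposition (adjunctSkeleton p') P, D'.size = D.size ∘ Sum.map id σ := by
  have h (e) : (adjunctSkeleton p).lo (Sum.map id σ e) = (adjunctSkeleton p').lo e ∧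
      (adjunctSkeleton p).hi (Sum.map id σ e) = (adjunctSkeleton p').hi e := by
    rcases e with k | c
    · exact ⟨rfl, rfl⟩
    · exact ⟨congrArg (·.1.1) (hσ c), congrArg (·.1.2) (hσ c)⟩
  exact ⟨D.relabel ((Equiv.refl _).sumCongr σ) (fun e ↦ (h e).1) fun e ↦ (h e).2, rfl⟩

end AdjunctSkeleton

section Matching

variable {n : ℕ} {ι P : Type*} [PartialOrder P]
  {p p' : ι → {q : Fin (n + 1) × Fin (n + 1) // q.1 < q.2}}
  {D : EdgeDecomposition (adjunctSkeleton p) P} {D' : EdgeDecomposition (adjunctSkeleton p') P}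

theorem edge_inl_subset_edge_inl (hnode : D.node = D'.node) (hp' : Wide p') (k : Fin n) :
    D.edge (.inl k) ⊆ D'.edge (.inl k) := by
  intro x hx
  obtain ⟨e, hxe⟩ := (D'.mem_range_or_mem_edge x).resolve_left <| by
    rintro ⟨l, rfl⟩
    exact D.node_notMem_edge l _ (hnode ▸ hx)
  have hlo := EdgeDecomposition.lo_eq_lo_of_node_eq hnode hx hxe
  have hhi := EdgeDecomposition.hi_eq_hi_of_node_eq hnode hx hxe
  rcases e with l | c
  · exact Fin.castSucc_injective n hlo ▸ hxe
  · have hlo' : (k : ℕ) = (p' c).1.1 := congrArg Fin.val hlo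
    have hhi' : (k : ℕ) + 1 = (p' c).1.2 := congrArg Fin.val hhi
    have := hp' c
    omega

theorem exists_edge_inr_eq_edge_inr (hnode : D.node = D'.node) (hp : Wide p) (c : ι) :
    ∃ d, p' d = p c ∧ D'.edge (.inr d) = D.edge (.inr c) := by
  obtain ⟨x, hx⟩ := D.nonempty_edge (essential_inr p c)
  obtain ⟨e, hxe⟩ := (D'.mem_range_or_mem_edge x).resolve_left <| by
    rintro ⟨l, rfl⟩
    exact D.node_notMem_edge l _ (hnode ▸ hx)
  have hlo := EdgeDecomposition.lo_eq_lo_of_node_eq hnode hx hxe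
  have hhi := EdgeDecomposition.hi_eq_hi_of_node_eq hnode hx hxe
  rcases e with l | d
  · have hlo' : ((p c).1.1 : ℕ) = l := congrArg Fin.val hlo
    have hhi' : ((p c).1.2 : ℕ) = l + 1 := congrArg Fin.val hhi
    have := hp c
    omega
  · exact ⟨d, Subtype.ext (Prod.ext hlo.symm hhi.symm),
      EdgeDecomposition.edge_eq_edge_of_node_eq hnode.symm hxe hx⟩

theorem size_inl_eq_size_inl (hnode : D.node = D'.node) (hp : Wide p) (hp' : Wide p') (k : Fin n) :
    D.size (.inl k) = D'.size (.inl k) :=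
  congrArg Set.ncard ((edge_inl_subset_edge_inl hnode hp' k).antisymm
    (edge_inl_subset_edge_inl hnode.symm hp k))

theorem exists_perm_size_inr_eq [Finite ι] (hnode : D.node = D'.node) (hp : Wide p) :
    ∃ σ : Equiv.Perm ι, ∀ c, p' (σ c) = p c ∧ D'.size (.inr (σ c)) = D.size (.inr c) := by
  choose s hs hedge using exists_edge_inr_eq_edge_inr hnode hp
  have hinj : Function.Injective s := by
    intro c d hcd
    obtain ⟨x, hx⟩ := D.nonempty_edge (essential_inr p c)
    have hx' : x ∈ D.edge (.inr d) := by
      rwa [← hedge d, ← hcd, hedge c]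
    exact Sum.inr_injective (D.eq_of_mem_edge hx hx')
  exact ⟨Equiv.ofBijective s (Finite.injective_iff_bijective.1 hinj),
    fun c ↦ ⟨hs c, congrArg Set.ncard (hedge c)⟩⟩

end Matching

section Blocks

variable {n m : ℕ}

theorem exists_equiv_adjunctSkeleton {E : Type*} [Finite E] {S : Skeleton (Fin (n + 1)) E}
    (hS : S.Joined) (hE : Nat.card E = n + m) :
    ∃ (p : Fin m → {q : Fin (n + 1) × Fin (n + 1) // q.1 < q.2}) (g : Fin n ⊕ Fin m ≃ E),
      (∀ e, S.lo (g e) = (adjunctSkeleton p).lo e) ∧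
        ∀ e, S.hi (g e) = (adjunctSkeleton p).hi e := by
  classical
  choose step hlo hhi using fun k : Fin n ↦
    hS (Fin.covBy_iff.2 (Nat.covBy_iff_add_one_eq.2 (Fin.val_succ k).symm) :
      k.castSucc ⋖ k.succ)
  have hinj : Function.Injective step := fun k l h ↦
    Fin.castSucc_injective n (by rw [← hlo, ← hlo, h])
  have hcard : Nat.card {e // e ∉ Set.range step} = m := by
    have hsum := Nat.card_congr (Equiv.sumCompl (· ∈ Set.range step))
    have hrange : Nat.card {e // e ∈ Set.range step} = n :=
      (Nat.card_range_of_injective hinj).trans (Nat.card_fin n)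
    rw [Nat.card_sum, hE, hrange] at hsum
    exact Nat.add_left_cancel hsum
  let g : Fin n ⊕ Fin m ≃ E := (Equiv.sumCongr (Equiv.ofInjective step hinj)
    (Finite.equivFinOfCardEq hcard).symm).trans (Equiv.sumCompl (· ∈ Set.range step))
  refine ⟨fun c ↦ ⟨(S.lo (g (.inr c)), S.hi (g (.inr c))), S.lo_lt_hi _⟩, g, ?_, ?_⟩
  · rintro (k | c)
    · exact hlo k
    · rfl
  · rintro (k | c)
    · exact hhi k
    · rfl

theorem exists_galoisConnection_of_isBot {K P : Type*} [LinearOrder K] [Finite K] [PartialOrder P]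
    (r : K ↪o P) {k : K} (hk : IsBot (r k)) : ∃ lo, GaloisConnection r lo := by
  have hmax (x : P) := (Set.toFinite {l | r l ≤ x}).exists_maximal ⟨k, hk x⟩
  choose lo hle hmax using hmax
  exact ⟨lo, fun l x ↦ ⟨fun hl ↦ (le_total l (lo x)).elim id fun h ↦ hmax x hl h,
    fun hl ↦ (r.monotone hl).trans (hle x)⟩⟩

theorem exists_galoisConnection_of_isTop {K P : Type*} [LinearOrder K] [Finite K] [PartialOrder P]
    (r : K ↪o P) {k : K} (hk : IsTop (r k)) : ∃ hi, GaloisConnection hi r := by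
  obtain ⟨hi, h⟩ := exists_galoisConnection_of_isBot r.dual (k := OrderDual.toDual k) hk
  exact ⟨OrderDual.ofDual ∘ hi ∘ OrderDual.toDual, fun x l ↦ (h (OrderDual.toDual l) x).symm⟩

variable {L : Type*} [Lattice L] [Finite L]

theorem IsRCBlock.exists_orderEmbedding (h : IsRCBlock L n m) :
    ∃ r : Fin n ↪o L, ∀ x, ¬ Irr x ↔ x ∈ Set.range r := by
  obtain ⟨-, hcard, hchain, -⟩ := h
  obtain ⟨g⟩ : Nonempty (Fin n ≃o {a : L | Reducible a}) :=
    nonempty_orderIso_of_card_eq le_total (fun x y ↦ hchain.total x.2 y.2)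
      ((Nat.card_fin n).trans hcard.symm)
  refine ⟨g.toOrderEmbedding.trans (OrderEmbedding.subtype _), fun x ↦ ?_⟩
  rw [← reducible_iff]
  refine ⟨fun hx ↦ ⟨g.symm ⟨x, hx⟩, congrArg Subtype.val (g.apply_symm_apply ⟨x, hx⟩)⟩, ?_⟩
  rintro ⟨k, rfl⟩
  exact (g k).2

theorem IsRCBlock.exists_edgeDecomposition (h : IsRCBlock L (n + 1) m) :
    ∃ p : Fin m → {q : Fin (n + 1) × Fin (n + 1) // q.1 < q.2},
      (adjunctSkeleton p).Branching ∧ Nonempty (EdgeDecomposition (adjunctSkeleton p) L) := by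
  obtain ⟨r, hr⟩ := h.exists_orderEmbedding
  obtain ⟨⟨⟨t, ht, ht'⟩, ⟨b, hb, hb'⟩⟩, -, -, hnull⟩ := h
  obtain ⟨k, rfl⟩ := (hr b).1 (reducible_iff.1 (Or.inl hb'))
  obtain ⟨l, rfl⟩ := (hr t).1 (reducible_iff.1 (Or.inr ht'))
  obtain ⟨lo, hlo⟩ := exists_galoisConnection_of_isBot r hb
  obtain ⟨hi, hhi⟩ := exists_galoisConnection_of_isTop r ht
  let D := coverDecomposition hlo hhi hr
  have hE : Nat.card {q : Fin (n + 1) × L // r q.1 ⋖ q.2} = n + m := by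
    have := (D.nullity_eq (joined_coverSkeleton hhi) hb).symm.trans hnull
    rw [Nat.card_fin] at this
    omega
  obtain ⟨p, g, hglo, hghi⟩ := exists_equiv_adjunctSkeleton (joined_coverSkeleton hhi) hE
  let D' := D.relabel g hglo hghi
  refine ⟨p, fun k hk ↦ (hr _).2 ⟨k, rfl⟩ ?_, ⟨D'⟩⟩
  exact (D'.irr_node_iff (joined_adjunctSkeleton p) k).2 hk

variable {p : Fin m → {q : Fin (n + 1) × Fin (n + 1) // q.1 < q.2}}

theorem isRCBlock_of_branching (hp : (adjunctSkeleton p).Branching)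
    (D : EdgeDecomposition (adjunctSkeleton p) L) : IsRCBlock L (n + 1) m := by
  have hS := joined_adjunctSkeleton p
  have hred : {a : L | Reducible a} = Set.range D.node :=
    Set.ext fun x ↦ reducible_iff.trans (D.not_irr_iff hS hp)
  have hbot : IsBot (D.node 0) := fun x ↦ by
    rcases D.mem_range_or_mem_edge x with ⟨k, rfl⟩ | ⟨e, hx⟩
    · exact D.node.le_iff_le.2 (Fin.zero_le k)
    · exact (D.node_le_iff hx).2 (Fin.zero_le _)
  have htop : IsTop (D.node (Fin.last n)) := fun x ↦ by
    rcases D.mem_range_or_mem_edge x with ⟨k, rfl⟩ | ⟨e, hx⟩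
    · exact D.node.le_iff_le.2 (Fin.le_last k)
    · exact (D.le_node_iff hx).2 (Fin.le_last _)
  have not_irr (k : Fin (n + 1)) : ¬ Irr (D.node k) := (D.not_irr_iff hS hp).2 ⟨k, rfl⟩
  refine ⟨⟨⟨_, htop, ?_⟩, ⟨_, hbot, ?_⟩⟩, ?_, ?_, ?_⟩
  · rw [joinReducible_iff]
    exact fun h ↦ not_irr _ ⟨h, fun y hy ↦ absurd (htop y) hy.lt.not_ge⟩
  · rw [meetReducible_iff]
    exact fun h ↦ not_irr _ ⟨fun y hy ↦ absurd (hbot y) hy.lt.not_ge, h⟩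
  · rw [hred, ← Nat.card_coe_set_eq, Nat.card_range_of_injective D.node.injective, Nat.card_fin]
  · rw [hred]
    rintro _ ⟨k, rfl⟩ _ ⟨l, rfl⟩ -
    exact (le_total k l).imp D.node.le_iff_le.2 D.node.le_iff_le.2
  · rw [D.nullity_eq hS hbot, Nat.card_sum, Nat.card_fin, Nat.card_fin, Nat.card_fin]
    push_cast
    ring

end Blocks

section ChainAdjunct

variable {p : Fin 3 → {q : Fin 4 × Fin 4 // q.1 < q.2}}

instance : Finite (ChainAdjunct p) :=
  Finite.of_surjective (Sum.elim .chain .pt : Fin 4 ⊕ Fin 3 → ChainAdjunct p)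
    fun | .chain x => ⟨.inl x, rfl⟩ | .pt c => ⟨.inr c, rfl⟩

/-- The decomposition of an iterated adjunct of a chain in which every attached edge carries one
element and the edges of the chain carry none. -/
def ChainAdjunct.edgeDecomposition (hp : Wide p) :
    EdgeDecomposition (adjunctSkeleton p) (ChainAdjunct p) where
  node := OrderEmbedding.ofMapLEIff .chain fun _ _ ↦ Iff.rfl
  edge := Sum.elim (fun _ ↦ ∅) fun c ↦ {.pt c}
  mem_range_or_mem_edge
    | .chain x => .inl ⟨x, rfl⟩
    | .pt c => .inr ⟨.inr c, Set.mem_singleton _⟩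
  isChain_edge
    | .inl _ => IsChain.empty
    | .inr _ => IsChain.singleton
  node_le_iff {e _} hx k := by
    rcases e with _ | c
    · exact hx.elim
    · rw [Set.mem_singleton_iff.1 hx]
      rfl
  le_node_iff {e _} hx k := by
    rcases e with _ | c
    · exact hx.elim
    · rw [Set.mem_singleton_iff.1 hx]
      rfl
  hi_le_lo {d e x y} hx hy hde hxy := by
    rcases d with _ | c <;> rcases e with _ | c'
    · exact hx.elim
    · exact hx.elim
    · exact hy.elim
    · obtain rfl := Set.mem_singleton_iff.1 hx
      obtain rfl := Set.mem_singleton_iff.1 hy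
      exact Or.resolve_left hxy fun h ↦ hde (congrArg _ h)
  nonempty_edge {e} he := by
    rcases e with k | c
    · exact absurd he (hp.not_essential_inl k)
    · exact Set.singleton_nonempty _

open Classical in
theorem ChainAdjunct.size_edgeDecomposition (hp : Wide p) :
    (edgeDecomposition hp).size = fun e ↦ if (adjunctSkeleton p).Essential e then 1 else 0 := by
  ext (k | c)
  · rw [if_neg (hp.not_essential_inl k)]
    exact Set.ncard_empty _
  · rw [if_pos (essential_inr p c)]
    exact Set.ncard_singleton _

theorem EdgeDecomposition.nonempty_orderIso_chainAdjunct {P : Type*} [PartialOrder P] [Finite P]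
    (D : EdgeDecomposition (adjunctSkeleton p) P) (hp : Wide p)
    (hp' : (adjunctSkeleton p).Branching) {B : Set P} (hB : IsBasicBlockOf B) :
    Nonempty (B ≃o ChainAdjunct p) := by
  obtain ⟨D', hD'⟩ := D.exists_size_eq_of_isBasicBlockOf (joined_adjunctSkeleton p) hp' hB
  exact D'.nonempty_orderIso_of_size_eq (ChainAdjunct.edgeDecomposition hp)
    (hD'.trans (ChainAdjunct.size_edgeDecomposition hp).symm)

theorem krullDim_fin_succ (n : ℕ) : Order.krullDim (Fin (n + 1)) = n := by
  refine le_antisymm (iSup_le fun l ↦ ?_)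
    (Order.le_krullDim_iff.2 ⟨⟨n, id, fun _ ↦ Fin.castSucc_lt_succ⟩, rfl⟩)
  have hcard := Fintype.card_le_of_injective l l.strictMono.injective
  rw [Fintype.card_fin, Fintype.card_fin] at hcard
  exact_mod_cast Nat.succ_le_succ_iff.1 hcard

theorem krullDim_chainAdjunct (hp : Wide p) : Order.krullDim (ChainAdjunct p) = 3 := by
  let height : ChainAdjunct p → Fin 4
    | .chain k => k
    | .pt c => ⟨(p c).1.1 + 1, (hp c).trans (p c).1.2.isLt⟩
  have hheight : StrictMono height := by
    intro x y hxy
    have hle : ChainAdjunct.le x y := hxy.le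
    rw [Fin.lt_def]
    rcases x with x | c <;> rcases y with y | d
    · exact lt_of_le_of_ne hle fun h ↦ hxy.ne (congrArg _ (Fin.ext h))
    · exact Nat.lt_succ_of_le hle
    · exact (hp c).trans_le hle
    · have hcd : ((p c).1.2 : ℕ) ≤ (p d).1.1 := Or.resolve_left hle fun h ↦ hxy.ne (congrArg _ h)
      exact (hp c).trans (Nat.lt_succ_of_le hcd)
  refine le_antisymm ?_ ?_
  · exact (Order.krullDim_le_of_strictMono height hheight).trans_eq (krullDim_fin_succ 3)
  · exact (krullDim_fin_succ 3).symm.trans_le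
      (Order.krullDim_le_of_strictMono _ (ChainAdjunct.edgeDecomposition hp).node.strictMono)

end ChainAdjunct

section BasicPairs

theorem wide_basicPairs : ∀ i, Wide (basicPairs i) := by
  unfold Wide
  decide

theorem branching_basicPairs (i : Fin 3) : (adjunctSkeleton (basicPairs i)).Branching := by
  rw [branching_adjunctSkeleton_iff]
  revert i
  decide

theorem basicPairs_swap : ∀ i ≠ 2, ∀ c, basicPairs i (Equiv.swap 1 2 c) = basicPairs i c := by
  decide

theorem basicPairs_perm : ∀ (i i' : Fin 3) (σ : Equiv.Perm (Fin 3)),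
    (∀ c, basicPairs i' (σ c) = basicPairs i c) →
      i = i' ∧ (σ = 1 ∨ i ≠ 2 ∧ σ = Equiv.swap 1 2) := by
  decide

theorem exists_eq_basicPairs {p : Fin 3 → {q : Fin 4 × Fin 4 // q.1 < q.2}} (hp : Wide p)
    (hp' : (adjunctSkeleton p).Branching) :
    ∃ (i : Fin 3) (σ : Equiv.Perm (Fin 3)), ∀ c, p (σ c) = basicPairs i c := by
  have hwide : ∀ q : {q : Fin 4 × Fin 4 // q.1 < q.2},
      (q.1.1 : ℕ) + 1 < q.1.2 → ∃ a, q = basicPairs 2 a := by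
    decide
  choose a ha using fun c ↦ hwide (p c) (hp c)
  obtain rfl : p = basicPairs 2 ∘ a := funext ha
  rw [branching_adjunctSkeleton_iff] at hp'
  clear ha hp hwide
  revert a
  decide

variable {i i' : Fin 3}

theorem exists_perm_size_eq {P Q : Type*} [PartialOrder P] [Finite P] [PartialOrder Q]
    (D : EdgeDecomposition (adjunctSkeleton (basicPairs i)) P)
    (D' : EdgeDecomposition (adjunctSkeleton (basicPairs i')) Q) (g : P ≃o Q) :
    i = i' ∧ ∃ σ : Equiv.Perm (Fin 3), (σ = 1 ∨ i ≠ 2 ∧ σ = Equiv.swap 1 2) ∧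
      D.size = D'.size ∘ Sum.map id σ := by
  obtain ⟨D'', hD''⟩ := D'.exists_size_eq_of_orderIso g
  have hnode : D.node = D''.node := D.node_eq_node D'' (joined_adjunctSkeleton _)
    (branching_basicPairs i) (joined_adjunctSkeleton _) (branching_basicPairs i')
  obtain ⟨σ, hσ⟩ := exists_perm_size_inr_eq hnode (wide_basicPairs i)
  obtain ⟨hi, hσ'⟩ := basicPairs_perm i i' σ fun c ↦ (hσ c).1
  refine ⟨hi, σ, hσ', ?_⟩
  rw [← hD'']
  ext (k | c)
  · exact size_inl_eq_size_inl hnode (wide_basicPairs i) (wide_basicPairs i') k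
  · exact (hσ c).2.symm

theorem eq_of_orderIso_basicB (g : BasicB i ≃o BasicB i') : i = i' :=
  (exists_perm_size_eq (ChainAdjunct.edgeDecomposition (wide_basicPairs i))
    (ChainAdjunct.edgeDecomposition (wide_basicPairs i')) g).1

variable {L : Type*} [Lattice L] [Finite L]

theorem isRCBlock_and_hasBasicBlockHeight_iff : IsRCBlock L 4 3 ∧ HasBasicBlockHeight L 3 ↔
    ∃ i, Nonempty (EdgeDecomposition (adjunctSkeleton (basicPairs i)) L) := by
  constructor
  · rintro ⟨hL, B, hB, hdim⟩
    obtain ⟨p, hp', ⟨D⟩⟩ := hL.exists_edgeDecomposition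
    obtain ⟨D', -⟩ := D.exists_size_eq_of_isBasicBlockOf (joined_adjunctSkeleton p) hp' hB
    obtain ⟨i, σ, hσ⟩ := exists_eq_basicPairs (wide_of_krullDim_le D' hdim.le) hp'
    obtain ⟨D'', -⟩ := D.exists_size_eq_comp_sumMap σ hσ
    exact ⟨i, ⟨D''⟩⟩
  · rintro ⟨i, ⟨D⟩⟩
    obtain ⟨B, hB⟩ := D.exists_isBasicBlockOf (joined_adjunctSkeleton _) (branching_basicPairs i)
    obtain ⟨g⟩ := D.nonempty_orderIso_chainAdjunct (wide_basicPairs i) (branching_basicPairs i) hB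
    exact ⟨isRCBlock_of_branching (branching_basicPairs i) D, B, hB,
      (Order.krullDim_eq_of_orderIso g).trans (krullDim_chainAdjunct (wide_basicPairs i))⟩

theorem isRCBlock_and_hasBasicBlock_iff : IsRCBlock L 4 3 ∧ HasBasicBlock L (BasicB i) ↔
    Nonempty (EdgeDecomposition (adjunctSkeleton (basicPairs i)) L) := by
  constructor
  · rintro ⟨hL, B, hB, ⟨g⟩⟩
    have hdim : Order.krullDim B = 3 :=
      (Order.krullDim_eq_of_orderIso g).trans (krullDim_chainAdjunct (wide_basicPairs i))
    obtain ⟨i', ⟨D⟩⟩ := isRCBlock_and_hasBasicBlockHeight_iff.1 ⟨hL, B, hB, hdim⟩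
    obtain ⟨g'⟩ :=
      D.nonempty_orderIso_chainAdjunct (wide_basicPairs i') (branching_basicPairs i') hB
    obtain rfl := eq_of_orderIso_basicB (g.symm.trans g')
    exact ⟨D⟩
  · rintro ⟨D⟩
    obtain ⟨B, hB⟩ := D.exists_isBasicBlockOf (joined_adjunctSkeleton _) (branching_basicPairs i)
    exact ⟨isRCBlock_of_branching (branching_basicPairs i) D, B, hB,
      D.nonempty_orderIso_chainAdjunct (wide_basicPairs i) (branching_basicPairs i) hB⟩

end BasicPairs

section Realization

variable {K E P : Type*} [LinearOrder K] [PartialOrder P] {S : Skeleton K E} {x y : P}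

namespace EdgeDecomposition

theorem exists_galoisConnection_node (D : EdgeDecomposition S P) :
    ∃ top : P → K, GaloisConnection top D.node := by
  choose top htop using fun x : P ↦ show ∃ k, ∀ l, k ≤ l ↔ x ≤ D.node l by
    rcases D.mem_range_or_mem_edge x with ⟨k, rfl⟩ | ⟨e, hx⟩
    · exact ⟨k, fun l ↦ D.node.le_iff_le.symm⟩
    · exact ⟨S.hi e, fun l ↦ (D.le_node_iff hx).symm⟩
  exact ⟨top, htop⟩

theorem node_le_of_not_le (D : EdgeDecomposition S P) {top : P → K}
    (htop : GaloisConnection top D.node) (hxy : ¬ x ≤ y) (hyx : ¬ y ≤ x) {z : P} (hx : x ≤ z)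
    (hy : y ≤ z) : D.node (top x) ≤ z := by
  rcases D.mem_range_or_mem_edge z with ⟨k, rfl⟩ | ⟨e, hz⟩
  · exact D.node.monotone (htop.l_le hx)
  rcases D.mem_edge_or_le_node_lo hz hx with hxe | hxe
  · rcases D.mem_edge_or_le_node_lo hz hy with hye | hye
    · exact ((D.isChain_edge e).total hxe hye).elim (absurd · hxy) (absurd · hyx)
    · exact absurd (hye.trans (D.node_lo_lt hxe).le) hyx
  · exact (D.node_le_iff hz).2 (htop.l_le hxe)

theorem exists_isLUB (D : EdgeDecomposition S P) (x y : P) : ∃ z, IsLUB {x, y} z := by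
  obtain ⟨top, htop⟩ := D.exists_galoisConnection_node
  by_cases hxy : x ≤ y
  · exact ⟨y, IsGreatest.isLUB ⟨.inr rfl, by simp [hxy]⟩⟩
  by_cases hyx : y ≤ x
  · exact ⟨x, IsGreatest.isLUB ⟨.inl rfl, by simp [hyx]⟩⟩
  refine ⟨D.node (max (top x) (top y)), ?_, fun z hz ↦ ?_⟩
  · rintro z (rfl | rfl)
    · exact htop.le_iff_le.1 (le_max_left _ _)
    · exact htop.le_iff_le.1 (le_max_right _ _)
  · have hx : x ≤ z := hz (.inl rfl)
    have hy : y ≤ z := hz (.inr rfl)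
    rcases max_choice (top x) (top y) with h | h <;> rw [h]
    · exact D.node_le_of_not_le htop hxy hyx hx hy
    · exact D.node_le_of_not_le htop hyx hxy hy hx

theorem exists_isGLB (D : EdgeDecomposition S P) (x y : P) : ∃ z, IsGLB {x, y} z :=
  D.dual.exists_isLUB x y

end EdgeDecomposition

/-- The poset obtained from the chain `K` by placing a chain of `s e` elements between the ends of
every edge `e` of the skeleton `S`. -/
inductive Skeleton.Realization (S : Skeleton K E) (s : E → ℕ)
  | node (k : K)
  | pt (e : E) (i : Fin (s e))

namespace Skeleton.Realization

variable {s : E → ℕ}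

/-- The order of the realization: points of the same edge are compared by their positions, all
other comparisons go through the ends of the edges. -/
def le : Realization S s → Realization S s → Prop
  | .node k, .node l => k ≤ l
  | .node k, .pt e _ => k ≤ S.lo e
  | .pt e _, .node l => S.hi e ≤ l
  | .pt e i, .pt d j => (e = d ∧ (i : ℕ) ≤ j) ∨ S.hi e ≤ S.lo d

instance : PartialOrder (Realization S s) where
  le := le
  le_refl
    | .node _ => le_refl _
    | .pt _ _ => .inl ⟨rfl, le_rfl⟩
  le_trans x y z hxy hyz := by
    rcases x with k | ⟨e, i⟩ <;> rcases y with l | ⟨d, j⟩ <;> rcases z with m | ⟨c, t⟩ <;>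
      simp only [le] at hxy hyz ⊢
    · exact hxy.trans hyz
    · exact hxy.trans hyz
    · exact hxy.trans ((S.lo_lt_hi d).le.trans hyz)
    · rcases hyz with ⟨rfl, -⟩ | hdc
      · exact hxy
      · exact hxy.trans ((S.lo_lt_hi d).le.trans hdc)
    · exact hxy.trans hyz
    · exact .inr (hxy.trans hyz)
    · rcases hxy with ⟨rfl, -⟩ | hed
      · exact hyz
      · exact hed.trans ((S.lo_lt_hi d).le.trans hyz)
    · rcases hxy with ⟨rfl, hij⟩ | hed <;> rcases hyz with ⟨rfl, hjt⟩ | hdc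
      · exact .inl ⟨rfl, hij.trans hjt⟩
      · exact .inr hdc
      · exact .inr hed
      · exact .inr (hed.trans ((S.lo_lt_hi d).le.trans hdc))
  le_antisymm x y hxy hyx := by
    rcases x with k | ⟨e, i⟩ <;> rcases y with l | ⟨d, j⟩ <;> simp only [le] at hxy hyx
    · rw [le_antisymm hxy hyx]
    · exact absurd (hyx.trans hxy) (S.lo_lt_hi d).not_ge
    · exact absurd (hxy.trans hyx) (S.lo_lt_hi e).not_ge
    · rcases hxy with ⟨rfl, hij⟩ | hed <;> rcases hyx with ⟨hde, hji⟩ | hde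
      · rw [Fin.ext (le_antisymm hij hji)]
      · exact absurd hde (S.lo_lt_hi e).not_ge
      · exact absurd (hde ▸ hed) (S.lo_lt_hi e).not_ge
      · exact absurd (hed.trans ((S.lo_lt_hi d).le.trans hde)) (S.lo_lt_hi e).not_ge

/-- The decomposition of the realization into its chain of nodes and the chains on its edges. -/
def edgeDecomposition (hs : ∀ e, S.Essential e → 0 < s e) :
    EdgeDecomposition S (Realization S s) where
  node := OrderEmbedding.ofMapLEIff .node fun _ _ ↦ Iff.rfl
  edge e := Set.range (.pt e)
  mem_range_or_mem_edge
    | .node k => .inl ⟨k, rfl⟩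
    | .pt e i => .inr ⟨e, i, rfl⟩
  isChain_edge := by
    rintro e _ ⟨i, rfl⟩ _ ⟨j, rfl⟩ -
    exact (le_total (i : ℕ) j).imp (fun h ↦ .inl ⟨rfl, h⟩) fun h ↦ .inl ⟨rfl, h⟩
  node_le_iff := by
    rintro e _ ⟨i, rfl⟩ k
    rfl
  le_node_iff := by
    rintro e _ ⟨i, rfl⟩ k
    rfl
  hi_le_lo := by
    rintro d e _ _ ⟨i, rfl⟩ ⟨j, rfl⟩ hde hxy
    exact Or.resolve_left hxy fun h ↦ hde h.1
  nonempty_edge {e} he := ⟨.pt e ⟨0, hs e he⟩, Set.mem_range_self _⟩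

theorem size_edgeDecomposition (hs : ∀ e, S.Essential e → 0 < s e) :
    (edgeDecomposition hs).size = s := by
  ext e
  have hinj : Function.Injective (Realization.pt (S := S) (s := s) e) := fun i j h ↦ by
    injection h
  exact (Nat.card_range_of_injective hinj).trans (Nat.card_fin _)

instance [Finite K] [Finite E] : Finite (Realization S s) :=
  Finite.of_surjective
    (Sum.elim .node fun q : Σ e, Fin (s e) ↦ .pt q.1 q.2 : K ⊕ (Σ e, Fin (s e)) → Realization S s)
    fun | .node k => ⟨.inl k, rfl⟩ | .pt e i => ⟨.inr ⟨e, i⟩, rfl⟩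

end Skeleton.Realization

theorem exists_lattice_size_eq [Finite K] [Fintype E] {s : E → ℕ}
    (hs : ∀ e, S.Essential e → 0 < s e) {α : Type*} [Finite α]
    (hα : Nat.card α = Nat.card K + ∑ e, s e) :
    ∃ (_ : Lattice α) (D : EdgeDecomposition S α), D.size = s := by
  let D := Skeleton.Realization.edgeDecomposition hs
  have hD : D.size = s := Skeleton.Realization.size_edgeDecomposition hs
  obtain ⟨g⟩ : Nonempty (α ≃ S.Realization s) := Finite.card_eq.1 (by rw [hα, D.card_eq, hD])
  let order : PartialOrder α := PartialOrder.lift g g.injective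
  obtain ⟨D', hD'⟩ := D.exists_size_eq_of_orderIso (Q := α) ⟨g, Iff.rfl⟩
  choose sup hsup using D'.exists_isLUB
  choose inf hinf using D'.exists_isGLB
  exact ⟨Lattice.ofIsLUBofIsGLB sup inf hsup hinf, D', hD'.trans hD⟩

end Realization

section Classification

theorem forall_fin_three {p : Fin 3 → Prop} : (∀ i, p i) ↔ p 0 ∧ p 1 ∧ p 2 :=
  Fin.forall_fin_succ.trans (and_congr_right' Fin.forall_fin_two)

/-- The poset `P` is the chain of four elements with `s e` elements placed on every edge `e`, the
edges besides those of the chain being attached at the adjunct pairs of the `i`-th basic block. -/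
def HasEdgeSizes (P : Type*) [PartialOrder P] (i : Fin 3) (s : Fin 3 ⊕ Fin 3 → ℕ) : Prop :=
  ∃ D : EdgeDecomposition (adjunctSkeleton (basicPairs i)) P, D.size = s

/-- The numbers of elements on the edges in a block on `j` elements of type `i`. For `i ≠ 2` the
last two adjunct pairs coincide, and their numbers are listed in increasing order. -/
def admissibleSizes (j : ℕ) (i : Fin 3) : Set (Fin 3 ⊕ Fin 3 → ℕ) :=
  {s | (∀ c, 0 < s (.inr c)) ∧ j = 4 + ∑ e, s e ∧ (i ≠ 2 → s (.inr 1) ≤ s (.inr 2))}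

variable {P Q : Type*} [PartialOrder P] [PartialOrder Q] [Finite P] {i i' : Fin 3}
  {s s' : Fin 3 ⊕ Fin 3 → ℕ} {j : ℕ}

theorem HasEdgeSizes.mem_admissibleSizes (h : HasEdgeSizes P i s) (hj : Nat.card P = j)
    (hs : i ≠ 2 → s (.inr 1) ≤ s (.inr 2)) : s ∈ admissibleSizes j i := by
  obtain ⟨D, rfl⟩ := h
  refine ⟨fun c ↦ (Set.ncard_pos (Set.toFinite _)).2 (D.nonempty_edge (essential_inr _ c)), ?_, hs⟩
  rw [← hj, D.card_eq, Nat.card_fin]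

theorem exists_hasEdgeSizes_mem_admissibleSizes
    (D : EdgeDecomposition (adjunctSkeleton (basicPairs i)) P) (hj : Nat.card P = j) :
    ∃ s ∈ admissibleSizes j i, HasEdgeSizes P i s := by
  by_cases hle : i ≠ 2 → D.size (.inr 1) ≤ D.size (.inr 2)
  · exact ⟨_, HasEdgeSizes.mem_admissibleSizes ⟨D, rfl⟩ hj hle, D, rfl⟩
  · obtain ⟨hi, hlt⟩ := Classical.not_imp.1 hle
    obtain ⟨D', hD'⟩ := D.exists_size_eq_comp_sumMap (Equiv.swap 1 2) (basicPairs_swap i hi)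
    exact ⟨_, HasEdgeSizes.mem_admissibleSizes ⟨D', hD'⟩ hj fun _ ↦ (not_le.1 hlt).le, D', hD'⟩

theorem eq_of_orderIso_of_mem_admissibleSizes (h : HasEdgeSizes P i s) (h' : HasEdgeSizes Q i s')
    (hs : s ∈ admissibleSizes j i) (hs' : s' ∈ admissibleSizes j i) (g : P ≃o Q) : s = s' := by
  obtain ⟨D, rfl⟩ := h
  obtain ⟨D', rfl⟩ := h'
  obtain ⟨-, σ, rfl | ⟨hi, rfl⟩, hsize⟩ := exists_perm_size_eq D D' g
  · rw [hsize, Equiv.Perm.coe_one, Sum.map_id_id, Function.comp_id]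
  · have h₁ : D.size (.inr 1) = D'.size (.inr 2) := congrFun hsize _
    have h₂ : D.size (.inr 2) = D'.size (.inr 1) := congrFun hsize _
    have hle := hs.2.2 hi
    have hle' := hs'.2.2 hi
    exact funext <| Sum.forall.2 ⟨fun k ↦ congrFun hsize (.inl k),
      forall_fin_three.2 ⟨congrFun hsize (.inr 0), by omega, by omega⟩⟩

theorem HasEdgeSizes.nonempty_orderIso [Finite Q] (h : HasEdgeSizes P i s)
    (h' : HasEdgeSizes Q i s) : Nonempty (P ≃o Q) := by
  obtain ⟨D, hD⟩ := h
  obtain ⟨D', hD'⟩ := h'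
  exact D.nonempty_orderIso_of_size_eq D' (hD.trans hD'.symm)

theorem exists_lattice_hasEdgeSizes {α : Type*} [Finite α]
    (hs : s ∈ admissibleSizes (Nat.card α) i) : ∃ _ : Lattice α, HasEdgeSizes α i s := by
  refine exists_lattice_size_eq (fun e he ↦ ?_) (hs.2.1.trans (by rw [Nat.card_fin]))
  rcases e with k | c
  · exact absurd he ((wide_basicPairs i).not_essential_inl k)
  · exact hs.1 c

variable {L M : Type*} [Lattice L] [Lattice M] [Finite L] [Finite M]

theorem isRCBlock_and_hasBasicBlock_iff_exists_hasEdgeSizes (hj : Nat.card L = j) :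
    IsRCBlock L 4 3 ∧ HasBasicBlock L (BasicB i) ↔
      ∃ s ∈ admissibleSizes j i, HasEdgeSizes L i s := by
  rw [isRCBlock_and_hasBasicBlock_iff]
  exact ⟨fun ⟨D⟩ ↦ exists_hasEdgeSizes_mem_admissibleSizes D hj, fun ⟨_, _, D, _⟩ ↦ ⟨D⟩⟩

theorem eq_of_orderIso_of_hasBasicBlock (hL : IsRCBlock L 4 3 ∧ HasBasicBlock L (BasicB i))
    (hM : IsRCBlock M 4 3 ∧ HasBasicBlock M (BasicB i')) (g : L ≃o M) : i = i' := by
  obtain ⟨D⟩ := isRCBlock_and_hasBasicBlock_iff.1 hL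
  obtain ⟨D'⟩ := isRCBlock_and_hasBasicBlock_iff.1 hM
  exact (exists_perm_size_eq D D' g).1

end Classification

section LatticeClasses

instance {α : Type*} [Finite α] : Finite (Lattice α) :=
  Finite.of_injective (fun L : Lattice α ↦ L.le) fun _ _ h ↦
    Lattice.ext fun x y ↦ iff_of_eq (congrFun₂ h x y)

instance (j : ℕ) : Finite (LatticeClass j) := Quotient.finite _

theorem blockClass_eq_iUnion (j : ℕ) :
    blockClass j 4 3 3 = ⋃ i, blockClassOfType j 4 3 (BasicB i) := by
  simp only [blockClass, blockClassOfType, isRCBlock_and_hasBasicBlockHeight_iff,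
    isRCBlock_and_hasBasicBlock_iff, Set.ofPred_exists, Set.image_iUnion]

theorem pairwise_disjoint_blockClassOfType (j : ℕ) :
    Pairwise (Function.onFun Disjoint fun i ↦ blockClassOfType j 4 3 (BasicB i)) := by
  refine fun i i' hne ↦ Set.disjoint_left.2 ?_
  rintro _ ⟨L, hL, rfl⟩ ⟨M, hM, hML⟩
  obtain ⟨g⟩ := Quotient.exact hML
  exact hne (@eq_of_orderIso_of_hasBasicBlock _ _ _ _ M L _ _ hM hL g).symm

theorem ncard_blockClass (j : ℕ) :
    (blockClass j 4 3 3).ncard = ∑ i, (blockClassOfType j 4 3 (BasicB i)).ncard := by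
  rw [blockClass_eq_iUnion, Set.ncard_iUnion_of_finite (fun _ ↦ Set.toFinite _)
    (pairwise_disjoint_blockClassOfType j), finsum_eq_sum_of_fintype]

theorem ncard_blockClassOfType (j : ℕ) (i : Fin 3) :
    (blockClassOfType j 4 3 (BasicB i)).ncard = (admissibleSizes j i).ncard := by
  have hiff (L : Lattice (Fin j)) := isRCBlock_and_hasBasicBlock_iff_exists_hasEdgeSizes
    (L := Fin j) (i := i) (Nat.card_fin j)
  choose M hM using fun s (hs : s ∈ admissibleSizes j i) ↦
    exists_lattice_hasEdgeSizes (α := Fin j) ((Nat.card_fin j).symm ▸ hs)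
  refine (Set.ncard_congr (fun s hs ↦ classOf (M s hs)) (fun s hs ↦ ?_) (fun s s' hs hs' h ↦ ?_)
    ?_).symm
  · exact ⟨M s hs, (hiff _).2 ⟨s, hs, hM s hs⟩, rfl⟩
  · obtain ⟨g⟩ := Quotient.exact h
    exact @eq_of_orderIso_of_mem_admissibleSizes _ _ (M s hs).toPartialOrder
      (M s' hs').toPartialOrder _ _ _ _ _ (hM s hs) (hM s' hs') hs hs' g
  · rintro _ ⟨L, hL, rfl⟩
    obtain ⟨s, hs, hLs⟩ := (hiff L).1 hL
    exact ⟨s, hs, Quotient.sound <| @HasEdgeSizes.nonempty_orderIso _ _ (M s hs).toPartialOrder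
      L.toPartialOrder _ _ _ _ (hM s hs) hLs⟩

end LatticeClasses

section Counting

theorem partitionCount_two (n : ℕ) : partitionCount n 2 = n / 2 := by
  have h : (Finset.Icc 1 (n / 2)).card = n / 2 := Nat.card_Icc 1 (n / 2)
  rw [partitionCount, ← h, eq_comm]
  refine Finset.card_bij (fun a ha ↦ ⟨{a, n - a}, fun {i} hi ↦ ?_, ?_⟩) (fun a ha ↦ ?_)
    (fun a ha b hb hab ↦ ?_) fun q hq ↦ ?_
  · have := Finset.mem_Icc.1 ha
    simp only [Multiset.insert_eq_cons, Multiset.mem_cons, Multiset.mem_singleton] at hi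
    omega
  · have := Finset.mem_Icc.1 ha
    rw [Multiset.insert_eq_cons, Multiset.sum_cons, Multiset.sum_singleton]
    omega
  · exact Finset.mem_filter.2 ⟨Finset.mem_univ _, rfl⟩
  · have := Finset.mem_Icc.1 ha
    have := Finset.mem_Icc.1 hb
    have hparts : ({a, n - a} : Multiset ℕ) = {b, n - b} := congrArg Nat.Partition.parts hab
    have hmem : a ∈ ({b, n - b} : Multiset ℕ) := hparts ▸ Multiset.mem_cons_self a _
    simp only [Multiset.insert_eq_cons, Multiset.mem_cons, Multiset.mem_singleton] at hmem
    omega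
  · obtain ⟨a, b, hparts, hle⟩ : ∃ a b, q.parts = {a, b} ∧ a ≤ b := by
      obtain ⟨a, b, hab⟩ := Multiset.card_eq_two.1 (Finset.mem_filter.1 hq).2
      rcases le_total a b with h | h
      exacts [⟨a, b, hab, h⟩, ⟨b, a, hab.trans (Multiset.pair_comm a b), h⟩]
    have hsum : a + b = n := by
      simpa only [hparts, Multiset.insert_eq_cons, Multiset.sum_cons, Multiset.sum_singleton]
        using q.parts_sum
    have hpos : 0 < a := q.parts_pos (hparts ▸ Multiset.mem_cons_self a _)
    refine ⟨a, Finset.mem_Icc.2 (by omega), Nat.Partition.ext ?_⟩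
    change ({a, n - a} : Multiset ℕ) = _
    rw [hparts, ← hsum, Nat.add_sub_cancel_left]

/-- The parameters `(s, r, l, t, a)` of the admissible sizes of a type with two equal adjunct
pairs: the lowest two edges of the chain carry `s - 1` and `r - 1` elements and the third one `t`;
the two parallel edges carry `a` and `l - a` elements with `a ≤ l - a`. -/
def sizeParameters (j : ℕ) : Finset (Σ _ : ℕ, Σ _ : ℕ, Σ _ : ℕ, ℕ × ℕ) :=
  (Finset.Icc 1 (j - 6)).sigma fun s ↦ (Finset.Icc 1 (j - s - 5)).sigma fun r ↦
    (Finset.Icc 2 (j - s - r - 3)).sigma fun l ↦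
      Finset.range (j - s - r - l - 2) ×ˢ Finset.Icc 1 (l / 2)

/-- The sizes with given parameters; the first adjunct edge carries the remaining elements. -/
def sizesOfParameters (j : ℕ) : (Σ _ : ℕ, Σ _ : ℕ, Σ _ : ℕ, ℕ × ℕ) → Fin 3 ⊕ Fin 3 → ℕ
  | ⟨s, r, l, t, a⟩ => Sum.elim ![s - 1, r - 1, t] ![j - s - r - l - 2 - t, a, l - a]

theorem mem_sizeParameters {j s r l t a : ℕ} :
    ⟨s, r, l, t, a⟩ ∈ sizeParameters j ↔
      (1 ≤ s ∧ s ≤ j - 6) ∧ (1 ≤ r ∧ r ≤ j - s - 5) ∧ (2 ≤ l ∧ l ≤ j - s - r - 3) ∧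
        t < j - s - r - l - 2 ∧ 1 ≤ a ∧ a ≤ l / 2 := by
  simp only [sizeParameters, Finset.mem_sigma, Finset.mem_Icc, Finset.mem_product,
    Finset.mem_range]

theorem card_sizeParameters (j : ℕ) :
    (sizeParameters j).card = ∑ s ∈ Finset.Icc 1 (j - 6), ∑ r ∈ Finset.Icc 1 (j - s - 5),
      ∑ l ∈ Finset.Icc 2 (j - s - r - 3), (j - s - r - l - 2) * partitionCount l 2 := by
  simp only [sizeParameters, Finset.card_sigma, Finset.card_product, Finset.card_range,
    Nat.card_Icc, partitionCount_two, Nat.add_sub_cancel]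

theorem injOn_sizesOfParameters (j : ℕ) : Set.InjOn (sizesOfParameters j) (sizeParameters j) := by
  rintro ⟨s, r, l, t, a⟩ h ⟨s', r', l', t', a'⟩ h' heq
  rw [Finset.mem_coe, mem_sizeParameters] at h h'
  have hs : s - 1 = s' - 1 := congrFun heq (.inl 0)
  have hr : r - 1 = r' - 1 := congrFun heq (.inl 1)
  obtain rfl : t = t' := congrFun heq (.inl 2)
  obtain rfl : a = a' := congrFun heq (.inr 1)
  have hl : l - a = l' - a := congrFun heq (.inr 2)
  obtain rfl : s = s' := by omega
  obtain rfl : r = r' := by omega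
  obtain rfl : l = l' := by omega
  rfl

theorem image_sizesOfParameters (j : ℕ) {i : Fin 3} (hi : i ≠ 2) :
    sizesOfParameters j '' sizeParameters j = admissibleSizes j i := by
  refine Set.Subset.antisymm ?_ ?_
  · rintro _ ⟨⟨s, r, l, t, a⟩, h, rfl⟩
    rw [Finset.mem_coe, mem_sizeParameters] at h
    refine ⟨forall_fin_three.2 ⟨?_, ?_, ?_⟩, ?_, fun _ ↦ ?_⟩
    · change 0 < j - s - r - l - 2 - t
      omega
    · change 0 < a
      omega
    · change 0 < l - a
      omega
    · rw [Fintype.sum_sum_type, Fin.sum_univ_three, Fin.sum_univ_three]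
      change j = 4 + ((s - 1 + (r - 1) + t) + (j - s - r - l - 2 - t + a + (l - a)))
      omega
    · change a ≤ l - a
      omega
  · rintro f ⟨hpos, hsum, hle⟩
    have hle := hle hi
    obtain ⟨hpos₀, hpos₁, hpos₂⟩ := forall_fin_three.1 hpos
    rw [Fintype.sum_sum_type, Fin.sum_univ_three, Fin.sum_univ_three] at hsum
    refine ⟨⟨f (.inl 0) + 1, f (.inl 1) + 1, f (.inr 1) + f (.inr 2), f (.inl 2), f (.inr 1)⟩,
      ?_, ?_⟩
    · rw [Finset.mem_coe, mem_sizeParameters]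
      omega
    · refine funext (Sum.forall.2 ⟨forall_fin_three.2 ⟨rfl, rfl, rfl⟩,
        forall_fin_three.2 ⟨?_, rfl, Nat.add_sub_cancel_left _ _⟩⟩)
      change j - (f (.inl 0) + 1) - (f (.inl 1) + 1) - (f (.inr 1) + f (.inr 2)) - 2 -
        f (.inl 2) = f (.inr 0)
      omega

theorem ncard_admissibleSizes_of_ne (j : ℕ) {i : Fin 3} (hi : i ≠ 2) :
    (admissibleSizes j i).ncard = ∑ s ∈ Finset.Icc 1 (j - 6), ∑ r ∈ Finset.Icc 1 (j - s - 5),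
      ∑ l ∈ Finset.Icc 2 (j - s - r - 3), (j - s - r - l - 2) * partitionCount l 2 := by
  rw [← image_sizesOfParameters j hi, (injOn_sizesOfParameters j).ncard_image,
    Set.ncard_coe_finset, card_sizeParameters]

theorem sum_choose_four_eq {j : ℕ} (hj : 7 ≤ j) :
    ∑ p ∈ Finset.Icc 1 (j - 6), (j - p - 2).choose 4 = (j - 2).choose 5 := by
  rw [show j - 2 = j - 3 + 1 by omega, ← Nat.sum_Icc_choose (j - 3) 4]
  refine Finset.sum_nbij' (fun p ↦ j - p - 2) (fun m ↦ j - m - 2) ?_ ?_ ?_ ?_ ?_ <;>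
    intro a ha <;> simp only [Finset.mem_Icc] at ha ⊢ <;> omega

theorem image_finsuppAntidiag_eq_admissibleSizes {j : ℕ} (hj : 7 ≤ j) :
    (fun f : Fin 3 ⊕ Fin 3 →₀ ℕ ↦ ⇑f + Sum.elim (0 : Fin 3 → ℕ) (1 : Fin 3 → ℕ)) ''
      (Finset.univ.finsuppAntidiag (j - 7) : Finset (Fin 3 ⊕ Fin 3 →₀ ℕ)) =
      admissibleSizes j 2 := by
  refine Set.Subset.antisymm ?_ ?_
  · rintro _ ⟨f, hf, rfl⟩
    have hsum := (Finset.mem_finsuppAntidiag.1 hf).1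
    refine ⟨fun _ ↦ Nat.succ_pos _, ?_, fun h ↦ absurd rfl h⟩
    simp only [Fintype.sum_sum_type, Fin.sum_univ_three, Pi.add_apply, Sum.elim_inl, Sum.elim_inr,
      Pi.zero_apply, Pi.one_apply] at hsum ⊢
    omega
  · rintro s ⟨hpos, hsum, -⟩
    have hle : Sum.elim (0 : Fin 3 → ℕ) (1 : Fin 3 → ℕ) ≤ s :=
      Sum.forall.2 ⟨fun _ ↦ Nat.zero_le _, hpos⟩
    refine ⟨Finsupp.equivFunOnFinite.symm (s - Sum.elim (0 : Fin 3 → ℕ) (1 : Fin 3 → ℕ)),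
      Finset.mem_finsuppAntidiag.2 ⟨?_, Finset.subset_univ _⟩, tsub_add_cancel_of_le hle⟩
    obtain ⟨hpos₀, hpos₁, hpos₂⟩ := forall_fin_three.1 hpos
    simp only [Finsupp.equivFunOnFinite_symm_apply_apply, Fintype.sum_sum_type,
      Fin.sum_univ_three, Pi.sub_apply, Sum.elim_inl, Sum.elim_inr, Pi.zero_apply,
      Pi.one_apply] at hsum ⊢
    omega

theorem ncard_admissibleSizes_two {j : ℕ} (hj : 7 ≤ j) :
    (admissibleSizes j 2).ncard = ∑ p ∈ Finset.Icc 1 (j - 6), (j - p - 2).choose 4 := by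
  have hinj : Function.Injective fun f : Fin 3 ⊕ Fin 3 →₀ ℕ ↦
      ⇑f + Sum.elim (0 : Fin 3 → ℕ) (1 : Fin 3 → ℕ) :=
    (add_left_injective _).comp DFunLike.coe_injective
  rw [← image_finsuppAntidiag_eq_admissibleSizes hj, Set.ncard_image_of_injective _ hinj,
    Set.ncard_coe_finset, Finset.card_finsuppAntidiag_nat_eq_choose, Finset.card_univ,
    Fintype.card_sum, Fintype.card_fin, show 3 + 3 + (j - 7) - 1 = j - 2 by omega,
    ← Nat.choose_symm (by omega), show j - 2 - (j - 7) = 5 by omega, sum_choose_four_eq hj]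

end Counting

end RCLattice

theorem mainTheorem3 (j : ℕ) (hj : 7 ≤ j) :
    (RCLattice.blockClass j 4 3 3).ncard
        = ∑ i : Fin 3, (RCLattice.blockClassOfType j 4 3 (RCLattice.BasicB i)).ncard ∧
      ∑ i : Fin 3, (RCLattice.blockClassOfType j 4 3 (RCLattice.BasicB i)).ncard
        = (∑ s ∈ Finset.Icc 1 (j - 6), ∑ r ∈ Finset.Icc 1 (j - s - 5),
            ∑ l ∈ Finset.Icc 2 (j - s - r - 3),
              2 * (j - s - r - l - 2) * RCLattice.partitionCount l 2)
          + ∑ p ∈ Finset.Icc 1 (j - 6), (j - p - 2).choose 4 := by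
  refine ⟨RCLattice.ncard_blockClass j, ?_⟩
  simp_rw [RCLattice.ncard_blockClassOfType, Fin.sum_univ_three]
  rw [RCLattice.ncard_admissibleSizes_of_ne j (by decide),
    RCLattice.ncard_admissibleSizes_of_ne j (by decide), RCLattice.ncard_admissibleSizes_two hj,
    ← two_mul]
  simp_rw [Finset.mul_sum, mul_assoc]
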